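/- Let $(T(t))_{t\ge 0}$ be an immediately differentiable $C_0$-semigroup (all orbits $t\mapsto T(t)x$ are differentiable on $(0,\infty)$) on a complex Banach space $X$ with generator $A$, and let $X_1$ be $\operatorname{dom}(A)$ with the graph norm. Let $V$ be a Banach space that embeds continuously into $X$ and such that $V$ is separable or the closed unit ball of $V$ is closed in $X$. Let $B(\kappa)\in\mathcal L(X_1,X)$ for $\kappa\in\mathbb C$, $|\kappa|<1$, with $B(0)=0$, and put $A(\kappa):=A+B(\kappa)$ with domain $\operatorname{dom}(A)$. Assume that $\kappa\mapsto A(\kappa)x\in X$ is holomorphic on $\{|\kappa|<1\}$ for each $x\in\operatorname{dom}(A)$, and that for each $\kappa$ the operator $B=B(\kappa)$ satisfies the following three conditions, in which the constants may depend on $\kappa$. (S1) There are $C\ge 1$ and $\alpha>0$ with $T(t)X\subseteq V$ and $\|T(t)\|_{X\to V}\le Ct^{-\alpha}$ for all $t\in(0,1]$. (S2) There are $q\in(0,1)$ and $t_0>0$ with $\int_0^{t_0}\|BT(s)x\|_X\,ds\le q\|x\|_X$ for all $x\in\operatorname{dom}(A)$. (S3) There are $C\ge 1$ and $\beta\in[0,1)$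 such that for all $t\in(0,1]$ one has $\|T(t)\|_{V\to V}\le C$, and such that $BT(t)x\in V$ and $\|BT(t)x\|_V\le Ct^{-\beta}\|x\|_V$ for all $x\in V$ with $T(t)x\in\operatorname{dom}(B)$. Let $\lambda_0\in\sigma(A)$ be a pole of the resolvent $R(\cdot,A)$ and an algebraically simple eigenvalue of $A$ (i.e. $\dim\bigcup_{m}\ker(\lambda_0-A)^m=1$), and let $r>0$ satisfy $\{\lambda:|\lambda-\lambda_0|\le r\}\cap\sigma(A)=\{\lambda_0\}$. Suppose that $$\sup_{|\lambda-\lambda_0|=r}\|B(\kappa)R(\lambda,A)\|_{\mathcal L(X)}\longrightarrow 0\qquad\text{as }\kappa\to 0 .$$ Then there is $\delta\in(0,1]$ such that for every $\kappa$ with $|\kappa|<\delta$ the operator $A(\kappa)$ has exactly one spectral value $\lambda(\kappa)$ in $\{\lambda:|\lambda-\lambda_0|<r\}$; this $\lambda(\kappa)$ is a pole of $R(\cdot,A(\kappa))$ and an algebraically simple eigenvalue of $A(\kappa)$, and the corresponding spectral projection $P(\kappa)$ has range contained in $V$ and restricts to a bounded operator on $V$. Moreover, on $\{|\kappa|<\delta\}$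 the map $\kappa\mapsto\lambda(\kappa)\in\mathbb C$ is analytic, and the map $\kappa\mapsto P(\kappa)$ is analytic both into $\mathcal L(X)$ and into $\mathcal L(V)$. -/

import Mathlib

open Filter Topology Set Metric

namespace AnalyticPerturbation

/-! ### Unbounded operators: resolvent, spectrum, poles, generalised eigenspaces

An operator `A : dom(A) ⊆ X → X` is a `LinearPMap`, written `X →ₗ.[ℂ] X`. The sum `A + B` is the
sum of partial linear maps, with domain `dom(A) ∩ dom(B)`. -/

section Operators

variable {X : Type*} [NormedAddCommGroup X] [NormedSpace ℂ X]

open Classical in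
/-- The value `A x` for `x ∈ dom(A)`, and `0` elsewhere. -/
noncomputable def val (A : X →ₗ.[ℂ] X) (x : X) : X :=
  if h : x ∈ A.domain then A ⟨x, h⟩ else 0

/-- The bounded operator `R` on `X` is a two-sided inverse of `z - A : dom(A) → X`. -/
def IsResolventAt (A : X →ₗ.[ℂ] X) (z : ℂ) (R : X →L[ℂ] X) : Prop :=
  (∀ y : X, ∃ h : R y ∈ A.domain, z • R y - A ⟨R y, h⟩ = y) ∧
    ∀ x : A.domain, R (z • (x : X) - A x) = x

/-- The resolvent set `ρ(A)`. -/
def resolventSet (A : X →ₗ.[ℂ] X) : Set ℂ :=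
  {z | ∃ R : X →L[ℂ] X, IsResolventAt A z R}

/-- The spectrum `σ(A) = ℂ ∖ ρ(A)`. -/
def spec (A : X →ₗ.[ℂ] X) : Set ℂ := (resolventSet A)ᶜ

open Classical in
/-- The resolvent `R(z, A) = (z - A)⁻¹` for `z ∈ ρ(A)`, and `0` for `z ∈ σ(A)`. -/
noncomputable def resolvent (A : X →ₗ.[ℂ] X) (z : ℂ) : X →L[ℂ] X :=
  if h : z ∈ resolventSet A then h.choose else 0

/-- `μ` is a spectral value of `A`, isolated in `σ(A)`, and the analytic map `z ↦ R(z, A)` has a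
pole at `μ`. -/
def IsResolventPole (A : X →ₗ.[ℂ] X) (μ : ℂ) : Prop :=
  μ ∈ spec A ∧ (∀ᶠ z in 𝓝[≠] μ, z ∈ resolventSet A) ∧
    MeromorphicAt (resolvent A) μ ∧ meromorphicOrderAt (resolvent A) μ < 0

/-- `ker (μ - A) ^ m`, where the powers carry their natural domains: `x ∈ ker (μ - A) ^ (m + 1)`
iff `x ∈ dom(A)` and `(μ - A) x ∈ ker (μ - A) ^ m`. -/
def kerPow (A : X →ₗ.[ℂ] X) (μ : ℂ) : ℕ → Submodule ℂ X
  | 0 => ⊥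
  | m + 1 => ((kerPow A μ m).comap (μ • A.domain.subtype - A.toFun)).map A.domain.subtype

/-- The generalised eigenspace `⋃ₘ ker (μ - A) ^ m` (the supremum of an increasing sequence of
subspaces). -/
def genEigenspace (A : X →ₗ.[ℂ] X) (μ : ℂ) : Submodule ℂ X := ⨆ m, kerPow A μ m

/-- `μ` is an algebraically simple eigenvalue of `A`. -/
def IsAlgSimple (A : X →ₗ.[ℂ] X) (μ : ℂ) : Prop :=
  Module.finrank ℂ (genEigenspace A μ) = 1

/-- `P` is the spectral projection of `A` associated with the isolated spectral value `μ`: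
`P = (2πi)⁻¹ ∮ R(z, A) dz` over a positively oriented circle around `μ` that, with its interior,
meets `σ(A)` in `μ` only. -/
def IsSpectralProjection (A : X →ₗ.[ℂ] X) (μ : ℂ) (P : X →L[ℂ] X) : Prop :=
  ∃ ε > 0, closedBall μ ε ∩ spec A = {μ} ∧
    P = (2 * (Real.pi : ℂ) * Complex.I)⁻¹ • ∮ z in C(μ, ε), resolvent A z

/-- `sup { ‖B R(z, A)‖ : |z - μ| = r } ∈ [0, ∞]`, with the operator norm as the supremum over the
closed unit ball of `X`. -/
noncomputable def relSup (A B : X →ₗ.[ℂ] X) (μ : ℂ) (r : ℝ) : ENNReal :=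
  ⨆ z ∈ sphere μ r, ⨆ x ∈ closedBall (0 : X) 1, ‖val B (resolvent A z x)‖ₑ

/-- `B` is defined exactly on `dom(A)` and is bounded from `dom(A)` with the graph norm to `X`. -/
def IsBoundedOnDomain (A B : X →ₗ.[ℂ] X) : Prop :=
  B.domain = A.domain ∧
    ∃ M : ℝ, ∀ (x : X) (hA : x ∈ A.domain) (hB : x ∈ B.domain),
      ‖B ⟨x, hB⟩‖ ≤ M * (‖x‖ + ‖A ⟨x, hA⟩‖)

end Operators

/-! ### Semigroups -/

section Semigroups

variable {X : Type*} [NormedAddCommGroup X] [NormedSpace ℂ X]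

/-- `(T(t))_{t ≥ 0}` is a `C₀`-semigroup on `X`; the values of `T` at negative times play no
role. -/
structure IsC0Semigroup (T : ℝ → X →L[ℂ] X) : Prop where
  map_zero : T 0 = 1
  map_add : ∀ s t, 0 ≤ s → 0 ≤ t → T (s + t) = T s * T t
  tendsto_zero : ∀ x, Tendsto (fun t => T t x) (𝓝[>] 0) (𝓝 x)

/-- `A` is the generator of `T`: `x ∈ dom(A)` and `A x = y` iff `(T(t) x - x) / t → y` as
`t ↓ 0`. -/
def IsGenerator (T : ℝ → X →L[ℂ] X) (A : X →ₗ.[ℂ] X) : Prop :=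
  ∀ x y : X, (x, y) ∈ A.graph ↔
    Tendsto (fun t : ℝ => t⁻¹ • (T t x - x)) (𝓝[>] 0) (𝓝 y)

/-- All orbits are differentiable on `(0, ∞)`. -/
def IsImmediatelyDifferentiable (T : ℝ → X →L[ℂ] X) : Prop :=
  ∀ x, DifferentiableOn ℝ (fun t => T t x) (Ioi 0)

end Semigroups

/-! ### The conditions (S1), (S2), (S3)

The continuous embedding of `V` into `X` is an injective bounded operator `ι : V → X`. -/

section Conditions

variable {X V : Type*} [NormedAddCommGroup X] [NormedSpace ℂ X]
  [NormedAddCommGroup V] [NormedSpace ℂ V]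

/-- (S1), ultracontractivity: `T(t) X ⊆ V` and `‖T(t)‖_{X → V} ≤ C t ^ (-α)` for `t ∈ (0, 1]`. -/
def CondS1 (ι : V →L[ℂ] X) (T : ℝ → X →L[ℂ] X) : Prop :=
  ∃ C α : ℝ, 1 ≤ C ∧ 0 < α ∧ ∀ t ∈ Ioc (0 : ℝ) 1, ∀ x : X,
    ∃ v : V, ι v = T t x ∧ ‖v‖ ≤ C * t ^ (-α) * ‖x‖

/-- (S2): `∫₀^{t₀} ‖B T(s) x‖ ds ≤ q ‖x‖` for `x ∈ dom(A)`. For `B` bounded on `dom(A)` with the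
graph norm the integrand is continuous on `[0, t₀]`, because `T` acts strongly continuously on
`dom(A)`. -/
def CondS2 (T : ℝ → X →L[ℂ] X) (A B : X →ₗ.[ℂ] X) : Prop :=
  ∃ q ∈ Ioo (0 : ℝ) 1, ∃ t₀ > 0, ∀ x ∈ A.domain,
    ∫ s in (0 : ℝ)..t₀, ‖val B (T s x)‖ ≤ q * ‖x‖

/-- (S3): `‖T(t)‖_{V → V} ≤ C`, and `B T(t) x ∈ V` with `‖B T(t) x‖_V ≤ C t ^ (-β) ‖x‖_V` whenever
`x ∈ V`, `t ∈ (0, 1]` and `T(t) x ∈ dom(B)`. -/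
def CondS3 (ι : V →L[ℂ] X) (T : ℝ → X →L[ℂ] X) (B : X →ₗ.[ℂ] X) : Prop :=
  ∃ C β : ℝ, 1 ≤ C ∧ β ∈ Ico (0 : ℝ) 1 ∧ ∀ t ∈ Ioc (0 : ℝ) 1, ∀ x : V,
    (∃ w : V, ι w = T t (ι x) ∧ ‖w‖ ≤ C * ‖x‖) ∧
    ∀ h : T t (ι x) ∈ B.domain,
      ∃ w : V, ι w = B ⟨T t (ι x), h⟩ ∧ ‖w‖ ≤ C * t ^ (-β) * ‖x‖

end Conditions

end AnalyticPerturbation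

/-!
Subtracting from `A` a suitable rank-one operator `φ(·) e` built from the simple pole `lam₀`
gives an operator `A'` whose resolvent set contains the closed disc. Write `B(κ) = C(κ) (lam₀ -
A')` with a bounded operator `C(κ)`; since `A(κ) x` is holomorphic for each `x`, the map `C` is
holomorphic in operator norm, and `C(0) = 0`. A Neumann series bounds the resolvent `Q(z)` of `A'
+ B(κ)` on the disc for small `κ`, and putting the rank-one operator back creates exactly one
spectral value there: the zero `λ(κ)` of `1 - φ(Q(z) e)`, which the implicit function theorem
makes simple and analytic in `κ`. Its eigenvector is `u(κ) = Q(λ(κ)) e`, and `P(κ) = ψ(κ)(·)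
u(κ)` has rank one, so everything reduces to the claim that `u` is holomorphic as a map into `V`.

The source `w = B(κ) u` lies in `V`, because it solves a Volterra equation whose kernel is
controlled by (S3) in `V` and by (S2) in `X`. Then `u = e^{-λ} T(1) u + ∫₀¹ e^{-λ s} T(s) w ds`
is a formula in `V`. As the constants in (S3) depend on `κ` uncontrollably, `‖T(s) w(κ)‖_V` is
bounded in `s` only for each fixed `κ`, whereas (S1) gives the locally uniform but non-integrable
bound `K s^{-α}`. Subharmonicity of `log⁺ ‖T(s) w(κ)‖_V` in `κ` upgrades these two to a locally
uniform integrable bound, as in Hartogs' lemma, and the integral is therefore holomorphic in `κ`.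
-/

namespace AnalyticPerturbation

/-! ### Growth of holomorphic functions with values in a Banach space -/

section Hartogs

open MeasureTheory Real

variable {E : Type*} [NormedAddCommGroup E]

theorem posLog_le_of_le_mul_rpow_neg {y K α s : ℝ} (hy : 0 ≤ y) (hs : 0 < s) (hα : 0 ≤ α)
    (hlog : 1 ≤ log s⁻¹) (hyK : y ≤ K * s ^ (-α)) :
    posLog y ≤ (posLog K + α) * log s⁻¹ := by
  have hrpow : posLog (s ^ (-α)) = α * log s⁻¹ := by
    rw [posLog_apply, log_rpow hs, neg_mul, ← mul_neg, ← log_inv, max_eq_right (by positivity)]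
  calc posLog y ≤ posLog K + posLog (s ^ (-α)) :=
        (monotoneOn_posLog hy (hy.trans hyK) hyK).trans posLog_mul
    _ ≤ posLog K * log s⁻¹ + α * log s⁻¹ := by
        rw [hrpow]
        gcongr
        exact le_mul_of_one_le_right posLog_nonneg hlog
    _ = _ := by ring

theorem tendsto_log_inv_nhdsGT_zero : Tendsto (fun s : ℝ => log s⁻¹) (𝓝[>] 0) atTop :=
  tendsto_log_atTop.comp tendsto_inv_nhdsGT_zero

theorem tendsto_lintegral_posLog_norm_div_log_inv {F : ℝ → ℂ → E} {c : ℂ} {ρ K α : ℝ}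
    (hα : 0 ≤ α)
    (hF : ∀ s ∈ Ioc (0 : ℝ) 1, ContinuousOn (F s) (ball c ρ))
    (hK : ∀ s ∈ Ioc (0 : ℝ) 1, ∀ z ∈ ball c ρ, ‖F s z‖ ≤ K * s ^ (-α))
    (hbdd : ∀ z ∈ ball c ρ, ∃ m, ∀ s ∈ Ioc (0 : ℝ) 1, ‖F s z‖ ≤ m) :
    Tendsto (fun s => ∫⁻ z in ball c ρ, ENNReal.ofReal (posLog ‖F s z‖ / log s⁻¹))
      (𝓝[>] 0) (𝓝 0) := by
  have hsmall : ∀ᶠ s in 𝓝[>] (0 : ℝ), s ∈ Ioc (0 : ℝ) 1 ∧ 1 ≤ log s⁻¹ :=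
    Filter.Eventually.and (Ioc_mem_nhdsGT zero_lt_one)
      (tendsto_log_inv_nhdsGT_zero.eventually_ge_atTop 1)
  rw [← lintegral_zero (μ := volume.restrict (ball c ρ))]
  refine tendsto_lintegral_filter_of_dominated_convergence'
    (fun _ => ENNReal.ofReal (posLog K + α)) ?_ ?_ ?_ ?_
  · filter_upwards [hsmall] with s ⟨hs, _⟩
    exact (ENNReal.continuous_ofReal.comp_continuousOn
      ((continuous_posLog.comp_continuousOn (hF s hs).norm).div_const _)).aemeasurable
      measurableSet_ball
  · filter_upwards [hsmall] with s ⟨hs, hlog⟩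
    filter_upwards [ae_restrict_mem measurableSet_ball] with z hz
    refine ENNReal.ofReal_le_ofReal ((div_le_iff₀ (by positivity)).2 ?_)
    exact posLog_le_of_le_mul_rpow_neg (norm_nonneg _) hs.1 hα hlog (hK s hs z hz)
  · rw [setLIntegral_const]
    exact ENNReal.mul_ne_top ENNReal.ofReal_ne_top measure_ball_lt_top.ne
  · filter_upwards [ae_restrict_mem measurableSet_ball] with z hz
    obtain ⟨m, hm⟩ := hbdd z hz
    have hle : ∀ᶠ s in 𝓝[>] (0 : ℝ), posLog ‖F s z‖ / log s⁻¹ ≤ posLog m / log s⁻¹ := by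
      filter_upwards [hsmall] with s ⟨hs, hlog⟩
      gcongr
      exact hm s hs
    have hnonneg : ∀ᶠ s in 𝓝[>] (0 : ℝ), 0 ≤ posLog ‖F s z‖ / log s⁻¹ := by
      filter_upwards [hsmall] with s ⟨_, hlog⟩
      exact div_nonneg posLog_nonneg (by positivity)
    simpa using ENNReal.tendsto_ofReal (squeeze_zero' hnonneg hle
      (tendsto_log_inv_nhdsGT_zero.const_div_atTop (posLog m)))

theorem log_norm_le_circleAverage {f : ℂ → ℂ} {c : ℂ} {R : ℝ} (hR : 0 < R)
    (hf : AnalyticOnNhd ℂ f (closedBall c |R|)) (hc : f c ≠ 0) :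
    log ‖f c‖ ≤ circleAverage (log ‖f ·‖) c R := by
  rw [hf.circleAverage_log_norm hR.ne' hc]
  refine le_add_of_nonneg_left (finsum_nonneg fun u => ?_)
  by_cases hu : u ∈ closedBall c |R|
  · refine mul_nonneg (by exact_mod_cast MeromorphicOn.AnalyticOnNhd.divisor_nonneg hf u) ?_
    rcases eq_or_ne u c with rfl | huc
    · simp
    · refine log_nonneg ?_
      rw [← div_eq_mul_inv, one_le_div (norm_sub_pos_iff.2 huc.symm)]
      simpa [dist_comm, dist_eq_norm, abs_of_pos hR, mem_closedBall] using hu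
  · rw [Function.locallyFinsuppWithin.apply_eq_zero_of_notMem _ hu]
    simp

variable [NormedSpace ℂ E]

theorem posLog_norm_le_circleAverage {F : ℂ → E} {c : ℂ} {R ρ : ℝ} (hR : 0 < R) (hRρ : R < ρ)
    (hF : DifferentiableOn ℂ F (ball c ρ)) :
    posLog ‖F c‖ ≤ circleAverage (fun z => posLog ‖F z‖) c R := by
  have hsub : closedBall c |R| ⊆ ball c ρ := by
    rw [abs_of_pos hR]; exact closedBall_subset_ball hRρ
  have hint : CircleIntegrable (fun z => posLog ‖F z‖) c R :=
    (continuous_posLog.comp_continuousOn (hF.continuousOn.mono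
      ((closedBall_subset_ball hRρ).trans' sphere_subset_closedBall)).norm).circleIntegrable hR.le
  rcases le_or_gt ‖F c‖ 1 with hFc | hFc
  · rw [(posLog_eq_zero_iff _).2 (by simpa using hFc)]
    exact circleAverage_nonneg_of_nonneg fun z _ => posLog_nonneg
  obtain ⟨l, hl, hlF⟩ := exists_dual_vector'' ℂ (F c)
  have hlc : ‖l (F c)‖ = ‖F c‖ := by rw [hlF]; simp
  have hlan : AnalyticOnNhd ℂ (fun z => l (F z)) (closedBall c |R|) :=
    ((l.differentiable.comp_differentiableOn hF).analyticOnNhd isOpen_ball).mono hsub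
  have hlog_le : ∀ z, log ‖l (F z)‖ ≤ posLog ‖F z‖ := fun z =>
    (le_max_right 0 _).trans (monotoneOn_posLog (norm_nonneg _) (norm_nonneg _)
      ((l.le_of_opNorm_le hl _).trans_eq (one_mul _)))
  calc posLog ‖F c‖ = log ‖l (F c)‖ := by
        rw [posLog_eq_log (by rw [abs_norm]; exact hFc.le), hlc]
    _ ≤ circleAverage (fun z => log ‖l (F z)‖) c R :=
        log_norm_le_circleAverage hR hlan (norm_pos_iff.1 (by rw [hlc]; linarith))
    _ ≤ circleAverage (fun z => posLog ‖F z‖) c R :=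
        circleAverage_mono
          (hlan.meromorphicOn.mono_set sphere_subset_closedBall).circleIntegrable_log_norm
          hint fun z _ => hlog_le z

theorem setLIntegral_ball_eq_polar {f : ℂ → ENNReal} (hf : Measurable f) (c : ℂ) (ρ : ℝ) :
    ∫⁻ z in ball c ρ, f z =
      ∫⁻ r in Ioo 0 ρ, ∫⁻ θ in Ioo (-π) π, ENNReal.ofReal r * f (circleMap c r θ) := by
  have hpolar : ∀ p : ℝ × ℝ, Complex.polarCoord.symm p + c = circleMap c p.1 p.2 := fun p => by
    simp only [Complex.polarCoord_symm_apply, circleMap, Complex.exp_mul_I, Complex.ofReal_cos,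
      Complex.ofReal_sin]
    ring
  have hmem : ∀ p : ℝ × ℝ, 0 < p.1 → (circleMap c p.1 p.2 ∈ ball c ρ ↔ p.1 < ρ) := fun p hp => by
    simp [circleMap, abs_of_pos hp]
  have hprod : Ioo 0 ρ ×ˢ Ioo (-π) π = polarCoord.target ∩ {p | p.1 < ρ} := by
    ext p
    simp only [polarCoord_target, mem_prod, mem_Ioo, mem_Ioi, mem_inter_iff, mem_ofPred_eq]
    tauto
  calc ∫⁻ z in ball c ρ, f z
      = ∫⁻ z, (ball c ρ).indicator f (z + c) := by
        rw [lintegral_add_right_eq_self, lintegral_indicator measurableSet_ball]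
    _ = ∫⁻ p in polarCoord.target,
          ENNReal.ofReal p.1 * (ball c ρ).indicator f (circleMap c p.1 p.2) := by
        rw [← Complex.lintegral_comp_polarCoord_symm]
        simp only [hpolar, smul_eq_mul]
    _ = ∫⁻ p in polarCoord.target, {p : ℝ × ℝ | p.1 < ρ}.indicator
          (fun p => ENNReal.ofReal p.1 * f (circleMap c p.1 p.2)) p := by
        refine setLIntegral_congr_fun polarCoord.open_target.measurableSet fun p hp => ?_
        have hp0 : 0 < p.1 := hp.1
        by_cases hpρ : p.1 < ρ <;> simp [indicator, hmem p hp0, hpρ]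
    _ = ∫⁻ p in Ioo 0 ρ ×ˢ Ioo (-π) π, ENNReal.ofReal p.1 * f (circleMap c p.1 p.2) := by
        rw [setLIntegral_indicator (measurableSet_lt measurable_fst measurable_const), hprod,
          inter_comm]
    _ = _ := by
        rw [Measure.volume_eq_prod, setLIntegral_prod]
        simp only [← hpolar, Complex.polarCoord_symm_apply]
        fun_prop

theorem ofReal_posLog_norm_le_lintegral_circleMap {F : ℂ → E} {c : ℂ} {r ρ : ℝ} (hr : 0 < r)
    (hrρ : r < ρ) (hF : DifferentiableOn ℂ F (ball c ρ)) :
    ENNReal.ofReal (2 * π * posLog ‖F c‖) ≤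
      ∫⁻ θ in Ioo (-π) π, ENNReal.ofReal (posLog ‖F (circleMap c r θ)‖) := by
  have hmem : ∀ θ, circleMap c r θ ∈ ball c ρ := fun θ => by
    simpa [circleMap, abs_of_pos hr] using hrρ
  have hcont : Continuous fun θ => posLog ‖F (circleMap c r θ)‖ :=
    continuous_posLog.comp
      (hF.continuousOn.comp_continuous (continuous_circleMap c r) hmem).norm
  rw [← ofReal_integral_eq_lintegral_ofReal
    ((hcont.integrableOn_Icc (a := -π) (b := π)).mono_set Ioo_subset_Icc_self)
    (ae_of_all _ fun θ => posLog_nonneg)]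
  refine ENNReal.ofReal_le_ofReal ?_
  have havg := posLog_norm_le_circleAverage hr hrρ hF
  rw [circleAverage_eq_integral_add (-π),
    intervalIntegral.integral_comp_add_right (fun θ => posLog ‖F (circleMap c r θ)‖), zero_add,
    show 2 * π + -π = π by ring, smul_eq_mul, inv_mul_eq_div, le_div_iff₀ two_pi_pos] at havg
  rwa [← integral_Ioc_eq_integral_Ioo,
    ← intervalIntegral.integral_of_le (by linarith [pi_pos]), mul_comm]

theorem posLog_norm_le_lintegral_ball {F : ℂ → E} {c : ℂ} {ρ : ℝ} (hρ : 0 ≤ ρ)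
    (hF : DifferentiableOn ℂ F (ball c ρ)) :
    ENNReal.ofReal (π * ρ ^ 2 * posLog ‖F c‖) ≤
      ∫⁻ z in ball c ρ, ENNReal.ofReal (posLog ‖F z‖) := by
  set f : ℂ → ENNReal := (ball c ρ).indicator fun z => ENNReal.ofReal (posLog ‖F z‖)
  have hf : Measurable f := by
    classical
    rw [show f = _ from (Set.piecewise_eq_indicator (f := fun z => ENNReal.ofReal _)).symm]
    exact (ENNReal.continuous_ofReal.comp_continuousOn
      (continuous_posLog.comp_continuousOn hF.continuousOn.norm)).measurable_piecewise
      continuousOn_const measurableSet_ball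
  have hradial : ∫⁻ r in Ioo 0 ρ, ENNReal.ofReal (2 * π * posLog ‖F c‖ * r) =
      ENNReal.ofReal (π * ρ ^ 2 * posLog ‖F c‖) := by
    rw [← ofReal_integral_eq_lintegral_ofReal
      ((continuous_const_mul _).integrableOn_Icc.mono_set Ioo_subset_Icc_self),
      ← integral_Ioc_eq_integral_Ioo, ← intervalIntegral.integral_of_le hρ,
      intervalIntegral.integral_const_mul, integral_id]
    · ring_nf
    · filter_upwards [ae_restrict_mem measurableSet_Ioo] with r hr
      have := posLog_nonneg (x := ‖F c‖)
      have := hr.1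
      positivity
  calc ENNReal.ofReal (π * ρ ^ 2 * posLog ‖F c‖)
      ≤ ∫⁻ r in Ioo 0 ρ, ∫⁻ θ in Ioo (-π) π, ENNReal.ofReal r * f (circleMap c r θ) := by
        rw [← hradial]
        refine setLIntegral_mono' measurableSet_Ioo fun r hr => ?_
        have hmem : ∀ θ, circleMap c r θ ∈ ball c ρ := fun θ => by
          simpa [circleMap, abs_of_pos hr.1] using hr.2
        rw [lintegral_const_mul' _ _ ENNReal.ofReal_ne_top, mul_comm, ENNReal.ofReal_mul hr.1.le]
        gcongr
        simpa only [f, indicator_of_mem (hmem _)] using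
          ofReal_posLog_norm_le_lintegral_circleMap hr.1 hr.2 hF
    _ = ∫⁻ z in ball c ρ, f z := (setLIntegral_ball_eq_polar hf c ρ).symm
    _ = ∫⁻ z in ball c ρ, ENNReal.ofReal (posLog ‖F z‖) :=
        setLIntegral_congr_fun measurableSet_ball fun z hz => indicator_of_mem hz _

theorem norm_le_rpow_of_lintegral_lt {F : ℂ → E} {c : ℂ} {ρ s ε : ℝ} (hρ : 0 < ρ)
    (hs : s ∈ Ioo (0 : ℝ) 1) (hF : DifferentiableOn ℂ F (ball c ρ))
    (hint : ∫⁻ z in ball c ρ, ENNReal.ofReal (posLog ‖F z‖ / log s⁻¹) <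
      ENNReal.ofReal (π * ρ ^ 2 * ε)) :
    ‖F c‖ ≤ s ^ (-ε) := by
  have hlog : 0 < log s⁻¹ := log_pos (one_lt_inv₀ hs.1 |>.2 hs.2)
  have hposLog : posLog ‖F c‖ ≤ ε * log s⁻¹ := by
    have hlt : ENNReal.ofReal (π * ρ ^ 2 * posLog ‖F c‖) <
        ENNReal.ofReal (log s⁻¹ * (π * ρ ^ 2 * ε)) := by
      calc ENNReal.ofReal (π * ρ ^ 2 * posLog ‖F c‖)
          ≤ ∫⁻ z in ball c ρ, ENNReal.ofReal (posLog ‖F z‖) :=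
            posLog_norm_le_lintegral_ball hρ.le hF
        _ = ENNReal.ofReal (log s⁻¹) *
              ∫⁻ z in ball c ρ, ENNReal.ofReal (posLog ‖F z‖ / log s⁻¹) := by
            rw [← lintegral_const_mul' _ _ ENNReal.ofReal_ne_top]
            simp only [← ENNReal.ofReal_mul hlog.le, mul_div_cancel₀ _ hlog.ne']
        _ < _ := by
            rw [ENNReal.ofReal_mul hlog.le]
            exact ENNReal.mul_lt_mul_right (ENNReal.ofReal_pos.2 hlog).ne'
              ENNReal.ofReal_ne_top hint
    rw [ENNReal.ofReal_lt_ofReal_iff_of_nonneg (mul_nonneg (by positivity) posLog_nonneg)] at hlt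
    have hπ : 0 < π * ρ ^ 2 := by positivity
    exact le_of_mul_le_mul_left (by linarith) hπ
  rcases (norm_nonneg (F c)).eq_or_lt with hzero | hpos
  · exact hzero ▸ rpow_nonneg hs.1.le _
  · rw [← log_le_log_iff hpos (rpow_pos_of_pos hs.1 _), log_rpow hs.1, neg_mul, ← mul_neg,
      ← log_inv]
    exact (le_max_right 0 _).trans hposLog

/-- A Hartogs-type statement: `log⁺ ‖F s ·‖` is subharmonic and, divided by `log s⁻¹`, tends to `0`
boundedly as `s → 0`, so its area means are eventually small uniformly in the centre. -/
theorem exists_forall_norm_le_mul_rpow_neg {F : ℝ → ℂ → E} {c : ℂ} {ρ K α ε : ℝ} (hρ : 0 < ρ)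
    (hα : 0 ≤ α) (hε : 0 < ε)
    (hF : ∀ s ∈ Ioc (0 : ℝ) 1, DifferentiableOn ℂ (F s) (ball c (2 * ρ)))
    (hK : ∀ s ∈ Ioc (0 : ℝ) 1, ∀ z ∈ ball c (2 * ρ), ‖F s z‖ ≤ K * s ^ (-α))
    (hbdd : ∀ z ∈ ball c (2 * ρ), ∃ m, ∀ s ∈ Ioc (0 : ℝ) 1, ‖F s z‖ ≤ m) :
    ∃ C, ∀ s ∈ Ioc (0 : ℝ) 1, ∀ z ∈ ball c ρ, ‖F s z‖ ≤ C * s ^ (-ε) := by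
  obtain ⟨s₁, hs₁, hsmall⟩ : ∃ s₁ > (0 : ℝ), ∀ s ∈ Ioo 0 s₁, ∀ z ∈ ball c ρ,
      ‖F s z‖ ≤ s ^ (-ε) := by
    have hint := (tendsto_lintegral_posLog_norm_div_log_inv hα
      (fun s hs => (hF s hs).continuousOn) hK hbdd).eventually_lt_const
      (ENNReal.ofReal_pos.2 (by positivity : 0 < π * ρ ^ 2 * ε))
    obtain ⟨s₁, hs₁, hsub⟩ := mem_nhdsGT_iff_exists_Ioo_subset.1
      (hint.and (Ioo_mem_nhdsGT (zero_lt_one' ℝ)))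
    refine ⟨s₁, hs₁, fun s hs z hz => ?_⟩
    have hball : ball z ρ ⊆ ball c (2 * ρ) := ball_subset_ball' (by linarith [mem_ball.1 hz])
    obtain ⟨hlt, hs01⟩ := hsub hs
    exact norm_le_rpow_of_lintegral_lt hρ hs01 ((hF s ⟨hs01.1, hs01.2.le⟩).mono hball)
      ((lintegral_mono_set hball).trans_lt hlt)
  refine ⟨max 1 (|K| * s₁ ^ (-α)), fun s hs z hz => ?_⟩
  have hone : 1 ≤ s ^ (-ε) := one_le_rpow_of_pos_of_le_one_of_nonpos hs.1 hs.2 (by linarith)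
  rcases lt_or_ge s s₁ with hlt | hge
  · exact (hsmall s ⟨hs.1, hlt⟩ z hz).trans
      (le_mul_of_one_le_left (by linarith) (le_max_left _ _))
  · calc ‖F s z‖ ≤ K * s ^ (-α) := hK s hs z (ball_subset_ball (by linarith) hz)
      _ ≤ |K| * s₁ ^ (-α) := mul_le_mul (le_abs_self K)
          (rpow_le_rpow_of_nonpos hs₁ hge (by linarith)) (rpow_nonneg hs.1.le _) (abs_nonneg _)
      _ ≤ max 1 (|K| * s₁ ^ (-α)) := le_max_right _ _
      _ ≤ _ := le_mul_of_one_le_right (le_max_of_le_left zero_le_one) hone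

end Hartogs

section StrongHolomorphy

variable {E F : Type*} [NormedAddCommGroup E] [NormedSpace ℂ E]
  [NormedAddCommGroup F] [NormedSpace ℂ F]

theorem lipschitzOnWith_of_differentiableOn_apply {C : ℂ → E →L[ℂ] F} {c : ℂ} {ρ : ℝ} {M : NNReal}
    (hρ : 0 < ρ) (hC : ∀ x, DifferentiableOn ℂ (fun κ => C κ x) (ball c (3 * ρ)))
    (hM : ∀ z ∈ ball c (3 * ρ), ‖C z‖ ≤ M) :
    LipschitzOnWith (2 * M / ρ.toNNReal) C (ball c ρ) := by
  refine LipschitzOnWith.of_dist_le_mul fun w hw z hz => ?_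
  have hball : ball z (2 * ρ) ⊆ ball c (3 * ρ) := ball_subset_ball' (by linarith [mem_ball.1 hz])
  have hwz : w ∈ ball z (2 * ρ) := by
    have := dist_triangle_right w z c
    rw [mem_ball] at hw hz ⊢
    linarith
  rw [dist_eq_norm]
  refine ContinuousLinearMap.opNorm_le_bound _ (by positivity) fun x => ?_
  have hmaps : MapsTo (fun κ => C κ x) (ball z (2 * ρ)) (closedBall (C z x) (2 * M * ‖x‖)) := by
    intro v hv
    rw [mem_closedBall, dist_eq_norm]
    linarith [norm_sub_le (C v x) (C z x), (C v).le_of_opNorm_le (hM v (hball hv)) x,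
      (C z).le_of_opNorm_le (hM z (hball (mem_ball_self (by positivity)))) x]
  have hschwarz := Complex.dist_le_div_mul_dist_of_mapsTo_ball ((hC x).mono hball) hmaps hwz
  rw [dist_eq_norm] at hschwarz
  calc ‖C w x - C z x‖ ≤ 2 * M * ‖x‖ / (2 * ρ) * dist w z := hschwarz
    _ ≤ 2 * M * ‖x‖ / ρ * dist w z := by gcongr; linarith
    _ = _ := by
      rw [NNReal.coe_div, Real.coe_toNNReal _ hρ.le, NNReal.coe_mul, NNReal.coe_ofNat]
      ring

theorem circleIntegral_apply {f : ℂ → E →L[ℂ] F} {c : ℂ} {R : ℝ} (hf : CircleIntegrable f c R)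
    (x : E) : (∮ z in C(c, R), f z) x = ∮ z in C(c, R), f z x :=
  ContinuousLinearMap.intervalIntegral_apply hf.out x

variable [CompleteSpace F]

theorem two_pi_I_inv_smul_circleIntegral_eq_of_forall_apply {C : ℂ → E →L[ℂ] F} {c w : ℂ} {R : ℝ}
    (hcont : ContinuousOn C (closedBall c R))
    (hC : ∀ x, DifferentiableOn ℂ (fun κ => C κ x) (closedBall c R)) (hw : w ∈ ball c R) :
    (2 * Real.pi * Complex.I : ℂ)⁻¹ • ∮ z in C(c, R), (z - w)⁻¹ • C z = C w := by
  have hint : CircleIntegrable (fun z => (z - w)⁻¹ • C z) c R := by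
    refine ContinuousOn.circleIntegrable (pos_of_mem_ball hw).le (ContinuousOn.fun_smul ?_
      (hcont.mono sphere_subset_closedBall))
    exact (continuousOn_id.sub continuousOn_const).inv₀ fun z hz =>
      sub_ne_zero.2 (ne_of_mem_of_not_mem hz hw.ne)
  ext x
  rw [smul_apply, circleIntegral_apply hint]
  simp only [smul_apply]
  rw [(hC x).circleIntegral_sub_inv_smul hw, inv_smul_smul₀ Complex.two_pi_I_ne_zero]

theorem differentiableOn_of_forall_apply [CompleteSpace E] {C : ℂ → E →L[ℂ] F} {U : Set ℂ}
    (hU : IsOpen U) (hC : ∀ x, DifferentiableOn ℂ (fun κ => C κ x) U) : DifferentiableOn ℂ C U := by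
  intro c hc
  obtain ⟨ρ, hρ, hρU⟩ : ∃ ρ > 0, closedBall c (3 * ρ) ⊆ U := by
    obtain ⟨ε, hε, hεU⟩ := nhds_basis_closedBall.mem_iff.1 (hU.mem_nhds hc)
    exact ⟨ε / 3, by positivity, by rwa [mul_div_cancel₀ _ three_ne_zero]⟩
  obtain ⟨M, hM⟩ : ∃ M, ∀ z : closedBall c (3 * ρ), ‖C z‖ ≤ M := by
    refine banach_steinhaus fun x => ?_
    obtain ⟨K, hK⟩ := (isCompact_closedBall c (3 * ρ)).exists_bound_of_continuousOn
      ((hC x).continuousOn.mono hρU)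
    exact ⟨K, fun z => hK z z.2⟩
  have hlip := lipschitzOnWith_of_differentiableOn_apply hρ
    (fun x => (hC x).mono (ball_subset_closedBall.trans hρU)) (M := M.toNNReal)
    fun z hz => (hM ⟨z, ball_subset_closedBall hz⟩).trans (Real.le_coe_toNNReal M)
  lift ρ / 2 to NNReal using by positivity with R hR
  have hRρ : closedBall c (R : ℝ) ⊆ ball c ρ := closedBall_subset_ball (by linarith)
  have hR0 : (0 : ℝ) < R := by linarith
  have hcont : ContinuousOn C (closedBall c R) := hlip.continuousOn.mono hRρ
  have hcauchy := hasFPowerSeriesOn_cauchy_integral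
    ((hcont.mono sphere_subset_closedBall).circleIntegrable hR0.le) (by exact_mod_cast hR0)
  refine (hcauchy.analyticAt.differentiableAt.congr_of_eventuallyEq ?_).differentiableWithinAt
  filter_upwards [ball_mem_nhds c hR0] with w hw
  refine (two_pi_I_inv_smul_circleIntegral_eq_of_forall_apply hcont (fun x => (hC x).mono ?_)
    hw).symm
  exact hRρ.trans ((ball_subset_ball (by linarith)).trans (ball_subset_closedBall.trans hρU))

end StrongHolomorphy

/-! ### Resolvents and perturbations that act on them -/

section Resolvent

variable {X : Type*} [NormedAddCommGroup X] [NormedSpace ℂ X] {A : X →ₗ.[ℂ] X}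

theorem mk_mem_graph_iff {x y : X} : (x, y) ∈ A.graph ↔ ∃ h : x ∈ A.domain, A ⟨x, h⟩ = y := by
  rw [LinearPMap.mem_graph_iff]
  constructor
  · rintro ⟨⟨x', hx'⟩, rfl, hy⟩
    exact ⟨hx', hy⟩
  · rintro ⟨hx, rfl⟩
    exact ⟨⟨x, hx⟩, rfl, rfl⟩

theorem val_eq_of_mem_graph {x y : X} (h : (x, y) ∈ A.graph) : val A x = y := by
  obtain ⟨hx, rfl⟩ := mk_mem_graph_iff.1 h
  exact dif_pos hx

theorem isResolventAt_iff {z : ℂ} {R : X →L[ℂ] X} : IsResolventAt A z R ↔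
    (∀ y, (R y, z • R y - y) ∈ A.graph) ∧ ∀ x a, (x, a) ∈ A.graph → R (z • x - a) = x := by
  refine and_congr (forall_congr' fun y => ?_) ⟨fun h x a hxa => ?_, fun h x => ?_⟩
  · rw [mk_mem_graph_iff]
    refine exists_congr fun h => ?_
    rw [sub_eq_iff_eq_add', eq_sub_iff_add_eq, eq_comm]
  · obtain ⟨hx, rfl⟩ := mk_mem_graph_iff.1 hxa
    exact h ⟨x, hx⟩
  · exact h x (A x) (A.mem_graph x)

namespace IsResolventAt

variable {z w : ℂ} {R S : X →L[ℂ] X}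

theorem apply_mem_graph (hR : IsResolventAt A z R) (y : X) : (R y, z • R y - y) ∈ A.graph :=
  (isResolventAt_iff.1 hR).1 y

theorem apply_sub (hR : IsResolventAt A z R) {x a : X} (hxa : (x, a) ∈ A.graph) :
    R (z • x - a) = x :=
  (isResolventAt_iff.1 hR).2 x a hxa

theorem mem_graph_iff (hR : IsResolventAt A z R) {x a : X} :
    (x, a) ∈ A.graph ↔ R (z • x - a) = x := by
  refine ⟨hR.apply_sub, fun h => ?_⟩
  have := hR.apply_mem_graph (z • x - a)
  rwa [h, sub_sub_cancel] at this

theorem isClosed (hR : IsResolventAt A z R) : A.IsClosed := by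
  have hgraph : (A.graph : Set (X × X)) = {p | R (z • p.1 - p.2) = p.1} :=
    Set.ext fun _ => hR.mem_graph_iff
  rw [LinearPMap.IsClosed, hgraph]
  exact isClosed_eq (by fun_prop) (by fun_prop)

theorem unique (hR : IsResolventAt A z R) (hS : IsResolventAt A z S) : R = S := by
  ext y
  simpa using hR.apply_sub (hS.apply_mem_graph y)

theorem resolvent_identity (hR : IsResolventAt A z R) (hS : IsResolventAt A w S) (y : X) :
    S y = R y + (z - w) • R (S y) := by
  calc S y = R (z • S y - (w • S y - y)) := (hR.apply_sub (hS.apply_mem_graph y)).symm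
    _ = R (y + (z - w) • S y) := by congr 1; rw [sub_smul]; abel
    _ = _ := by rw [map_add, map_smul]

theorem mul_inverse (hR : IsResolventAt A z R) {G : X →ₗ.[ℂ] X} {D : X →L[ℂ] X}
    (hD : IsUnit (1 - D))
    (hG : ∀ x y, (x, y) ∈ G.graph ↔
      ∃ a, (x, a) ∈ A.graph ∧ w • x - y = (1 - D) (z • x - a)) :
    IsResolventAt G w (R * Ring.inverse (1 - D)) := by
  have hright : ∀ y, (1 - D) (Ring.inverse (1 - D) y) = y :=
    DFunLike.congr_fun (Ring.mul_inverse_cancel _ hD)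
  have hleft : ∀ y, Ring.inverse (1 - D) ((1 - D) y) = y :=
    DFunLike.congr_fun (Ring.inverse_mul_cancel _ hD)
  refine isResolventAt_iff.2 ⟨fun y => (hG _ _).2
    ⟨_, hR.apply_mem_graph (Ring.inverse (1 - D) y), ?_⟩, fun x g hxg => ?_⟩
  · rw [mul_apply_eq_comp, sub_sub_cancel, sub_sub_cancel, hright]
  · obtain ⟨a, hxa, heq⟩ := (hG x g).1 hxg
    rw [heq, mul_apply_eq_comp, hleft, hR.apply_sub hxa]

theorem of_isUnit (hR : IsResolventAt A z R) (hw : IsUnit (1 - (z - w) • R)) :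
    IsResolventAt A w (R * Ring.inverse (1 - (z - w) • R)) := by
  have hshift : ∀ x a, (x, a) ∈ A.graph → w • x - a = (1 - (z - w) • R) (z • x - a) := by
    intro x a hxa
    rw [sub_apply, smul_apply, hR.apply_sub hxa, one_apply_eq_self, sub_smul]
    abel
  refine hR.mul_inverse hw fun x y => ⟨fun hxy => ⟨y, hxy, hshift x y hxy⟩, ?_⟩
  rintro ⟨a, hxa, heq⟩
  rw [← hshift x a hxa] at heq
  rwa [sub_right_injective heq]

end IsResolventAt

theorem isResolventAt_resolvent {z : ℂ} (hz : z ∈ resolventSet A) :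
    IsResolventAt A z (resolvent A z) := by
  rw [resolvent, dif_pos hz]
  exact hz.choose_spec

theorem IsResolventAt.resolvent_eq {z : ℂ} {R : X →L[ℂ] X} (hR : IsResolventAt A z R) :
    resolvent A z = R :=
  (isResolventAt_resolvent ⟨R, hR⟩).unique hR

theorem mem_resolventSet_of_norm_smul_lt_one [CompleteSpace X] {z w : ℂ}
    (hz : z ∈ resolventSet A) (h : ‖(z - w) • resolvent A z‖ < 1) : w ∈ resolventSet A :=
  ⟨_, (isResolventAt_resolvent hz).of_isUnit (isUnit_one_sub_of_norm_lt_one h)⟩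

theorem analyticAt_resolvent [CompleteSpace X] {z : ℂ} (hz : z ∈ resolventSet A) :
    AnalyticAt ℂ (resolvent A) z := by
  have hsub : AnalyticAt ℂ (fun w => 1 - (z - w) • resolvent A z) z := by fun_prop
  have hone : 1 - (z - z) • resolvent A z = ((1 : (X →L[ℂ] X)ˣ) : X →L[ℂ] X) := by simp
  have hinv : AnalyticAt ℂ (fun w => Ring.inverse (1 - (z - w) • resolvent A z)) z :=
    AnalyticAt.fun_comp (hone ▸ analyticAt_inverse _) hsub
  have hmul : AnalyticAt ℂ
      (fun w => resolvent A z * Ring.inverse (1 - (z - w) • resolvent A z)) z :=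
    analyticAt_const.mul hinv
  refine hmul.congr ?_
  filter_upwards [hsub.continuousAt.eventually_mem (Units.isOpen.mem_nhds ⟨1, hone.symm⟩)]
    with w hw
  exact ((isResolventAt_resolvent hz).of_isUnit hw).resolvent_eq.symm

/-- The operator `A + L` with domain `dom(A)`, for a bounded operator `L` on `X`. -/
def addBounded (A : X →ₗ.[ℂ] X) (L : X →L[ℂ] X) : X →ₗ.[ℂ] X := (L : X →ₗ[ℂ] X) +ᵥ A

theorem mem_graph_addBounded {L : X →L[ℂ] X} {x y : X} :
    (x, y) ∈ (addBounded A L).graph ↔ (x, y - L x) ∈ A.graph := by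
  rw [mk_mem_graph_iff, mk_mem_graph_iff]
  refine exists_congr fun _ => ?_
  rw [eq_sub_iff_add_eq']
  rfl

theorem addBounded_neg_addBounded (A : X →ₗ.[ℂ] X) (L : X →L[ℂ] X) :
    addBounded (addBounded A (-L)) L = A :=
  LinearPMap.eq_of_eq_graph <| by
    ext ⟨x, y⟩
    simp only [mem_graph_addBounded, neg_apply, sub_neg_eq_add, sub_add_cancel]

theorem mem_graph_add {B : X →ₗ.[ℂ] X} {x a b : X} (ha : (x, a) ∈ A.graph)
    (hb : (x, b) ∈ B.graph) : (x, a + b) ∈ (A + B).graph := by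
  obtain ⟨hxA, rfl⟩ := mk_mem_graph_iff.1 ha
  obtain ⟨hxB, rfl⟩ := mk_mem_graph_iff.1 hb
  exact mk_mem_graph_iff.2 ⟨⟨hxA, hxB⟩, rfl⟩

/-- `B` is defined on `dom(A)` and equals `C (z₀ - A)` there. -/
def FactorsThrough (A B : X →ₗ.[ℂ] X) (z₀ : ℂ) (C : X →L[ℂ] X) : Prop :=
  ∀ x a, (x, a) ∈ A.graph → (x, C (z₀ • x - a)) ∈ B.graph

theorem FactorsThrough.mem_graph_add_iff {B : X →ₗ.[ℂ] X} {z₀ : ℂ} {C : X →L[ℂ] X}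
    (hB : FactorsThrough A B z₀ C) {x y : X} :
    (x, y) ∈ (A + B).graph ↔ ∃ a, (x, a) ∈ A.graph ∧ y = a + C (z₀ • x - a) := by
  refine ⟨fun hxy => ?_, ?_⟩
  · obtain ⟨⟨hxA, hxB⟩, rfl⟩ := mk_mem_graph_iff.1 hxy
    have hA := A.mem_graph ⟨x, hxA⟩
    refine ⟨A ⟨x, hxA⟩, hA, ?_⟩
    rw [← (mk_mem_graph_iff.1 (hB x _ hA)).2]
    rfl
  · rintro ⟨a, hxa, rfl⟩
    exact mem_graph_add hxa (hB x a hxa)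

theorem exists_continuousLinearMap_forall_mem_graph {B : X →ₗ.[ℂ] X} {z₀ : ℂ} {R : X →L[ℂ] X}
    (hR : IsResolventAt A z₀ R) (hB : IsBoundedOnDomain A B) :
    ∃ C : X →L[ℂ] X, ∀ y, (R y, C y) ∈ B.graph := by
  obtain ⟨hdom, M, hM⟩ := hB
  have hRA : ∀ y, ∃ h : R y ∈ A.domain, A ⟨R y, h⟩ = z₀ • R y - y := fun y =>
    mk_mem_graph_iff.1 (hR.apply_mem_graph y)
  have hRB : ∀ y, R y ∈ B.domain := fun y => hdom ▸ (hRA y).1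
  refine ⟨(B.toFun ∘ₗ (R : X →ₗ[ℂ] X).codRestrict B.domain hRB).mkContinuous
    (|M| * (‖R‖ + (‖z₀‖ * ‖R‖ + 1))) fun y => ?_, fun y => B.mem_graph ⟨R y, hRB y⟩⟩
  obtain ⟨hyA, hyR⟩ := hRA y
  calc ‖B ⟨R y, hRB y⟩‖ ≤ M * (‖R y‖ + ‖A ⟨R y, hyA⟩‖) := hM _ _ _
    _ ≤ |M| * (‖R y‖ + (‖z₀ • R y‖ + ‖y‖)) := by
        rw [hyR]
        gcongr
        exacts [le_abs_self M, norm_sub_le _ _]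
    _ ≤ |M| * (‖R‖ * ‖y‖ + (‖z₀‖ * (‖R‖ * ‖y‖) + ‖y‖)) := by
        rw [norm_smul]
        gcongr <;> exact R.le_opNorm y
    _ = _ := by ring

theorem IsBoundedOnDomain.exists_factorsThrough {B : X →ₗ.[ℂ] X} {z₀ : ℂ} {R : X →L[ℂ] X}
    (hR : IsResolventAt A z₀ R) (hB : IsBoundedOnDomain A B) :
    ∃ C : X →L[ℂ] X, FactorsThrough A B z₀ C := by
  obtain ⟨C, hC⟩ := exists_continuousLinearMap_forall_mem_graph hR hB
  refine ⟨C, fun x a hxa => ?_⟩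
  simpa only [hR.apply_sub hxa] using hC (z₀ • x - a)

end Resolvent

/-! ### Poles of the resolvent -/

section Pole

variable {X : Type*} [NormedAddCommGroup X] [NormedSpace ℂ X] {A : X →ₗ.[ℂ] X} {μ : ℂ}

theorem mem_kerPow_succ {m : ℕ} {x : X} :
    x ∈ kerPow A μ (m + 1) ↔ ∃ a, (x, a) ∈ A.graph ∧ μ • x - a ∈ kerPow A μ m := by
  rw [kerPow, Submodule.mem_map]
  constructor
  · rintro ⟨y, hy, rfl⟩
    exact ⟨A y, A.mem_graph y, hy⟩
  · rintro ⟨a, ha, h⟩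
    obtain ⟨hx, rfl⟩ := mk_mem_graph_iff.1 ha
    exact ⟨⟨x, hx⟩, h, rfl⟩

theorem mem_genEigenspace_of_mem_kerPow {m : ℕ} {x : X} (h : x ∈ kerPow A μ m) :
    x ∈ genEigenspace A μ :=
  (le_iSup (kerPow A μ) m) h

theorem mem_kerPow_one {x : X} (h : (x, μ • x) ∈ A.graph) : x ∈ kerPow A μ 1 :=
  mem_kerPow_succ.2 ⟨μ • x, h, by simp [kerPow]⟩

theorem IsAlgSimple.exists_smul_eq (h : IsAlgSimple A μ) {x y : X}
    (hx : x ∈ genEigenspace A μ) (hx0 : x ≠ 0) (hy : y ∈ genEigenspace A μ) :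
    ∃ c : ℂ, c • x = y := by
  obtain ⟨c, hc⟩ := exists_smul_eq_of_finrank_eq_one h (x := (⟨x, hx⟩ : genEigenspace A μ))
    (by simpa [Subtype.ext_iff] using hx0) ⟨y, hy⟩
  exact ⟨c, by simpa [Subtype.ext_iff] using hc⟩

theorem IsAlgSimple.mem_graph_of_mem_kerPow (h : IsAlgSimple A μ) {e x : X} {m : ℕ}
    (he : (e, μ • e) ∈ A.graph) (he0 : e ≠ 0) (hx : x ∈ kerPow A μ m) :
    (x, μ • x) ∈ A.graph := by
  obtain ⟨c, rfl⟩ := h.exists_smul_eq (mem_genEigenspace_of_mem_kerPow (mem_kerPow_one he)) he0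
    (mem_genEigenspace_of_mem_kerPow hx)
  rw [smul_comm, ← Prod.smul_mk]
  exact A.graph.smul_mem c he

theorem mem_and_deriv_mem_of_eventually_mem {E : Type*} [NormedAddCommGroup E] [NormedSpace ℂ E]
    {M : Submodule ℂ E} (hM : IsClosed (M : Set E)) {f : ℂ → E} {f' : E}
    (hf : HasDerivAt f f' μ) (h : ∀ᶠ z in 𝓝[≠] μ, f z ∈ M) : f μ ∈ M ∧ f' ∈ M := by
  have hμ : f μ ∈ M :=
    hM.mem_of_tendsto (hf.continuousAt.tendsto.mono_left nhdsWithin_le_nhds) h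
  refine ⟨hμ, hM.mem_of_tendsto (hasDerivAt_iff_tendsto_slope.1 hf) ?_⟩
  filter_upwards [h] with z hz
  exact M.smul_mem _ (M.sub_mem hz hμ)

theorem IsResolventPole.exists_pow_smul_resolvent_eq (h : IsResolventPole A μ) :
    ∃ (n : ℕ) (g : ℂ → X →L[ℂ] X), AnalyticAt ℂ g μ ∧ g μ ≠ 0 ∧
      ∀ᶠ z in 𝓝[≠] μ, (z - μ) ^ (n + 1) • resolvent A z = g z := by
  obtain ⟨-, -, hmer, hord⟩ := h
  obtain ⟨k, hk⟩ := WithTop.ne_top_iff_exists.1 hord.ne_top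
  obtain ⟨g, hg, hg0, hgeq⟩ := (meromorphicOrderAt_eq_int_iff hmer).1 hk.symm
  have hk0 : k < 0 := by rw [← hk] at hord; exact_mod_cast hord
  obtain ⟨n, rfl⟩ : ∃ n : ℕ, k = -((n : ℤ) + 1) := ⟨(-k - 1).toNat, by omega⟩
  refine ⟨n, g, hg, hg0, ?_⟩
  filter_upwards [hgeq, self_mem_nhdsWithin] with z hz hne
  rw [hz, smul_smul, ← zpow_natCast, ← zpow_add₀ (sub_ne_zero.2 hne)]
  simp

/-- With `n + 1` the order of the pole and `g` as in `exists_pow_smul_resolvent_eq`, the pairs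
`(g(z) y, z g(z) y - (z - μ)ⁿ⁺¹ y)` lie in the closed graph of `A`. Hence `g(μ) y` is an
eigenvector, and for `n ≥ 1` differentiation at `μ` yields `(A - μ) g'(μ) y = g(μ) y`, which
contradicts simplicity. -/
theorem IsResolventPole.exists_residue (h : IsResolventPole A μ) (hsimple : IsAlgSimple A μ) :
    ∃ Q : X →L[ℂ] X, Q ≠ 0 ∧
      Tendsto (fun z => (z - μ) • resolvent A z) (𝓝[≠] μ) (𝓝 Q) ∧
      ∀ y, (Q y, μ • Q y) ∈ A.graph := by
  obtain ⟨z₀, hz₀⟩ := h.2.1.exists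
  have hclosed : A.IsClosed := (isResolventAt_resolvent hz₀).isClosed
  obtain ⟨n, g, hg, hg0, hgR⟩ := h.exists_pow_smul_resolvent_eq
  have hev : ∀ y, ∀ᶠ z in 𝓝[≠] μ, (g z y, z • g z y - (z - μ) ^ (n + 1) • y) ∈ A.graph := by
    intro y
    filter_upwards [hgR, h.2.1] with z hz hzA
    have := A.graph.smul_mem ((z - μ) ^ (n + 1)) ((isResolventAt_resolvent hzA).apply_mem_graph y)
    rwa [Prod.smul_mk, smul_sub, smul_comm, ← smul_apply, hz] at this
  have hderiv : ∀ y, HasDerivAt (fun z => (g z y, z • g z y - (z - μ) ^ (n + 1) • y))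
      (deriv g μ y, (μ • deriv g μ y + g μ y) - ((n + 1 : ℕ) * 0 ^ n : ℂ) • y) μ := by
    intro y
    have hgy : HasDerivAt (fun z => g z y) (deriv g μ y) μ :=
      hg.differentiableAt.hasDerivAt.clm_apply (hasDerivAt_const μ y) |>.congr_deriv (by simp)
    have hpow : HasDerivAt (fun z : ℂ => (z - μ) ^ (n + 1)) ((n + 1 : ℕ) * 0 ^ n) μ := by
      simpa using ((hasDerivAt_id μ).sub_const μ).fun_pow (n + 1)
    refine hgy.prodMk (((hasDerivAt_id μ).fun_smul hgy).fun_sub (hpow.smul_const y)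
      |>.congr_deriv ?_)
    simp
  have heig : ∀ y, (g μ y, μ • g μ y) ∈ A.graph := fun y => by
    simpa using (mem_and_deriv_mem_of_eventually_mem hclosed (hderiv y) (hev y)).1
  have hn : n = 0 := by
    by_contra hn
    obtain ⟨y, hy⟩ : ∃ y, g μ y ≠ 0 := by
      by_contra! hall
      exact hg0 (ContinuousLinearMap.ext hall)
    have hgen : (deriv g μ y, μ • deriv g μ y + g μ y) ∈ A.graph := by
      simpa [hn] using (mem_and_deriv_mem_of_eventually_mem hclosed (hderiv y) (hev y)).2
    have hker : deriv g μ y ∈ kerPow A μ 2 := mem_kerPow_succ.2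
      ⟨_, hgen, by simpa using mem_kerPow_one (heig y)⟩
    have := LinearPMap.mem_graph_snd_inj A
      (hsimple.mem_graph_of_mem_kerPow (heig y) hy hker) hgen rfl
    exact hy (by simpa using this)
  refine ⟨g μ, hg0, ?_, heig⟩
  exact (hg.continuousAt.tendsto.mono_left nhdsWithin_le_nhds).congr' <|
    hgR.mono fun z hz => by rw [← hz, hn, zero_add, pow_one]

variable {F : ℂ → X →L[ℂ] X}

theorem isResolventPole_of_eventually_isResolventAt (hμ : μ ∈ spec A) (hF : AnalyticAt ℂ F μ)
    (hF0 : F μ ≠ 0) (h : ∀ᶠ z in 𝓝[≠] μ, IsResolventAt A z ((z - μ)⁻¹ • F z)) :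
    IsResolventPole A μ := by
  have heq : ∀ᶠ z in 𝓝[≠] μ, resolvent A z = (z - μ) ^ (-1 : ℤ) • F z :=
    h.mono fun z hz => by rw [hz.resolvent_eq, zpow_neg_one]
  have hmer : MeromorphicAt (resolvent A) μ := by
    have hzpow : MeromorphicAt (fun z : ℂ => (z - μ) ^ (-1 : ℤ)) μ := by fun_prop
    exact (hzpow.smul hF.meromorphicAt).congr (heq.mono fun z hz => hz.symm)
  refine ⟨hμ, h.mono fun z hz => ⟨_, hz⟩, hmer, ?_⟩
  rw [(meromorphicOrderAt_eq_int_iff hmer).2 ⟨F, hF, hF0, heq⟩]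
  exact_mod_cast neg_one_lt_zero (R := ℤ)

theorem isSpectralProjection_of_eventually_isResolventAt [CompleteSpace X] (hμ : μ ∈ spec A)
    (hF : AnalyticAt ℂ F μ) (h : ∀ᶠ z in 𝓝[≠] μ, IsResolventAt A z ((z - μ)⁻¹ • F z)) :
    IsSpectralProjection A μ (F μ) := by
  obtain ⟨ε, hε, hball⟩ := nhds_basis_closedBall.eventually_iff.1
    (hF.eventually_analyticAt.and (eventually_nhdsWithin_iff.1 h))
  have hres : ∀ z ∈ closedBall μ ε, z ≠ μ → IsResolventAt A z ((z - μ)⁻¹ • F z) :=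
    fun z hz => (hball hz).2
  refine ⟨ε, hε, Subset.antisymm ?_ ?_, ?_⟩
  · rintro z ⟨hz, hzA⟩
    by_contra hne
    exact hzA ⟨_, hres z hz hne⟩
  · rintro z rfl
    exact ⟨mem_closedBall_self hε.le, hμ⟩
  · have hF' : DifferentiableOn ℂ F (closedBall μ ε) := fun z hz =>
      (hball hz).1.differentiableAt.differentiableWithinAt
    have heq : EqOn (resolvent A) (fun z => (z - μ)⁻¹ • F z) (sphere μ ε) := fun z hz =>
      (hres z (sphere_subset_closedBall hz) (ne_of_mem_sphere hz hε.ne')).resolvent_eq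
    rw [circleIntegral.integral_congr hε.le heq,
      hF'.circleIntegral_sub_inv_smul (mem_ball_self hε),
      inv_smul_smul₀ Complex.two_pi_I_ne_zero]

end Pole

/-! ### Rank-one perturbations -/

section RankOne

variable {X : Type*} [NormedAddCommGroup X] [NormedSpace ℂ X] {A : X →ₗ.[ℂ] X} {z μ : ℂ}
  {R S : X →L[ℂ] X} {φ : X →L[ℂ] ℂ} {e : X}

theorem IsResolventAt.addBounded_smulRight (hR : IsResolventAt A z R) (h : φ (R e) ≠ 1) :
    IsResolventAt (addBounded A (φ.smulRight e)) z
      (R + (1 - φ (R e))⁻¹ • (φ ∘L R).smulRight (R e)) := by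
  have h' : 1 - φ (R e) ≠ 0 := sub_ne_zero.2 h.symm
  have happly : ∀ y, (R + (1 - φ (R e))⁻¹ • (φ ∘L R).smulRight (R e)) y =
      R (y + ((1 - φ (R e))⁻¹ * φ (R y)) • e) := fun y => by
    simp [mul_smul]
  refine isResolventAt_iff.2 ⟨fun y => ?_, fun x a hxa => ?_⟩
  · have hφ : φ (R (y + ((1 - φ (R e))⁻¹ * φ (R y)) • e)) = (1 - φ (R e))⁻¹ * φ (R y) := by
      rw [map_add, map_add, map_smul, map_smul, smul_eq_mul]
      field_simp
      ring
    rw [happly, mem_graph_addBounded, ContinuousLinearMap.smulRight_apply, hφ, sub_sub]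
    exact hR.apply_mem_graph _
  · have hx : R (z • x - a) = x - φ x • R e := by
      have := hR.apply_sub (mem_graph_addBounded.1 hxa)
      rw [ContinuousLinearMap.smulRight_apply, ← sub_add, map_add, map_smul] at this
      exact eq_sub_of_add_eq this
    rw [happly, map_add, map_smul, hx, map_sub, map_smul, smul_eq_mul, ← mul_one_sub,
      mul_left_comm, inv_mul_cancel₀ h', mul_one, sub_add_cancel]

theorem IsResolventAt.mem_graph_addBounded_smulRight (hR : IsResolventAt A μ R)
    (h : φ (R e) = 1) : (R e, μ • R e) ∈ (addBounded A (φ.smulRight e)).graph := by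
  rw [mem_graph_addBounded, ContinuousLinearMap.smulRight_apply, h, one_smul]
  exact hR.apply_mem_graph e

theorem mem_spec_of_mem_graph {x : X} (hx : (x, μ • x) ∈ A.graph) (hx0 : x ≠ 0) :
    μ ∈ spec A := by
  rintro ⟨S, hS⟩
  exact hx0 (by simpa using (hS.apply_sub hx).symm)

theorem IsResolventAt.isAlgSimple_addBounded_smulRight (hR : IsResolventAt A μ R)
    (h : φ (R e) = 1) (h' : φ (R (R e)) ≠ 0) :
    IsAlgSimple (addBounded A (φ.smulRight e)) μ := by
  have hle : ∀ m, kerPow (addBounded A (φ.smulRight e)) μ m ≤ Submodule.span ℂ {R e} := by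
    intro m
    induction m with
    | zero => exact bot_le
    | succ m ih =>
      intro x hx
      obtain ⟨a, hxa, ha⟩ := mem_kerPow_succ.1 hx
      obtain ⟨c, hc⟩ := Submodule.mem_span_singleton.1 (ih ha)
      have hxR : x = c • R (R e) + φ x • R e := by
        have := hR.apply_sub (mem_graph_addBounded.1 hxa)
        rw [ContinuousLinearMap.smulRight_apply, ← sub_add, ← hc, map_add, map_smul,
          map_smul] at this
        exact this.symm
      have hc0 : c = 0 := by
        have := congrArg φ hxR
        rw [map_add, map_smul, map_smul, h, smul_eq_mul, smul_eq_mul, mul_one,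
          right_eq_add] at this
        exact (mul_eq_zero.1 this).resolve_right h'
      rw [hc0, zero_smul, zero_add] at hxR
      exact Submodule.mem_span_singleton.2 ⟨φ x, hxR.symm⟩
  have hgen : genEigenspace (addBounded A (φ.smulRight e)) μ = Submodule.span ℂ {R e} := by
    refine le_antisymm (iSup_le hle) ((Submodule.span_singleton_le_iff_mem _ _).2 ?_)
    exact mem_genEigenspace_of_mem_kerPow (mem_kerPow_one (hR.mem_graph_addBounded_smulRight h))
  rw [IsAlgSimple, hgen]
  refine finrank_span_singleton fun h0 => ?_
  rw [h0, map_zero] at h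
  exact zero_ne_one h

/-- The first resolvent identity turns a zero `w` of `1 - φ(R(·, A) e)` into a linear factor. -/
theorem IsResolventAt.one_sub_eq_mul (hR : IsResolventAt A z R) (hS : IsResolventAt A μ S)
    (h : φ (S e) = 1) : 1 - φ (R e) = (z - μ) * φ (R (S e)) := by
  have := congrArg φ (hR.resolvent_identity hS e)
  rw [h, map_add, map_smul, smul_eq_mul] at this
  exact sub_eq_of_eq_add' this

/-- The operator multiplied by `(z - μ)⁻¹` extends analytically to `z = μ`. -/
theorem IsResolventAt.addBounded_smulRight_of_eq_one (hR : IsResolventAt A z R)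
    (hS : IsResolventAt A μ S) (h : φ (S e) = 1) (hz : z ≠ μ) (h' : φ (R (S e)) ≠ 0) :
    IsResolventAt (addBounded A (φ.smulRight e)) z
      ((z - μ)⁻¹ • ((z - μ) • R + (φ (R (S e)))⁻¹ • (φ ∘L R).smulRight (R e))) := by
  have heq := hR.one_sub_eq_mul hS h
  have hne : φ (R e) ≠ 1 := fun h1 => by
    rw [h1, sub_self, zero_eq_mul] at heq
    exact heq.elim (sub_ne_zero.2 hz) h'
  convert hR.addBounded_smulRight hne using 1
  rw [smul_add, inv_smul_smul₀ (sub_ne_zero.2 hz), smul_smul, heq, mul_inv]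

end RankOne

/-! ### Deflation of the unperturbed eigenvalue -/

section Deflation

variable {X : Type*} [NormedAddCommGroup X] [NormedSpace ℂ X] {A : X →ₗ.[ℂ] X} {lam₀ : ℂ} {r : ℝ}

/-- Removal of the eigenvalue `lam₀` with eigenvector `e`: subtracting the rank-one operator
`φ(·) e` from `A` moves the disc `|z - lam₀| ≤ r` into the resolvent set. -/
structure IsDeflation (A : X →ₗ.[ℂ] X) (lam₀ : ℂ) (r : ℝ) (e : X) (φ : X →L[ℂ] ℂ) : Prop where
  eigenvector : (e, lam₀ • e) ∈ A.graph
  apply_ne_zero : φ e ≠ 0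
  subset_resolventSet : closedBall lam₀ r ⊆ resolventSet (addBounded A (-(φ.smulRight e)))

theorem IsResolventAt.apply_eigenvector {z : ℂ} {R : X →L[ℂ] X} (hR : IsResolventAt A z R) {e : X}
    (he : (e, lam₀ • e) ∈ A.graph) (hz : z ≠ lam₀) : R e = (z - lam₀)⁻¹ • e := by
  rw [eq_inv_smul_iff₀ (sub_ne_zero.2 hz), ← map_smul, sub_smul]
  exact hR.apply_sub he

theorem IsResolventPole.exists_rankOne_residue (hpole : IsResolventPole A lam₀)
    (hsimple : IsAlgSimple A lam₀) :
    ∃ (e : X) (φ : X →L[ℂ] ℂ), φ e = 1 ∧ (e, lam₀ • e) ∈ A.graph ∧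
      (∀ x a, (x, a) ∈ A.graph → φ a = lam₀ * φ x) ∧
      Tendsto (fun z => (z - lam₀) • resolvent A z) (𝓝[≠] lam₀) (𝓝 (φ.smulRight e)) := by
  obtain ⟨Q, hQ0, hQ, hQA⟩ := hpole.exists_residue hsimple
  obtain ⟨y, hy⟩ : ∃ y, Q y ≠ 0 := by
    by_contra! hall
    exact hQ0 (ContinuousLinearMap.ext hall)
  obtain ⟨ψ, hψ⟩ := SeparatingDual.exists_eq_one (R := ℂ) hy
  have hQeq : (ψ ∘L Q).smulRight (Q y) = Q := by
    ext x
    obtain ⟨c, hc⟩ := hsimple.exists_smul_eq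
      (mem_genEigenspace_of_mem_kerPow (mem_kerPow_one (hQA y))) hy
      (mem_genEigenspace_of_mem_kerPow (mem_kerPow_one (hQA x)))
    simp [← hc, hψ]
  have hQapply {f : ℂ → X} {y : X} (hf : Tendsto f (𝓝[≠] lam₀) (𝓝 y)) :
      Tendsto (fun z => (z - lam₀) • resolvent A z (f z)) (𝓝[≠] lam₀) (𝓝 (Q y)) :=
    (isBoundedBilinearMap_apply.continuous.tendsto (Q, y)).comp (hQ.prodMk_nhds hf)
  have hQgraph : ∀ x a, (x, a) ∈ A.graph → Q (lam₀ • x - a) = 0 := by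
    intro x a hxa
    have hsub : Tendsto (fun z => z • x - a) (𝓝[≠] lam₀) (𝓝 (lam₀ • x - a)) :=
      ((by fun_prop : Continuous fun z : ℂ => z • x - a).tendsto _).mono_left nhdsWithin_le_nhds
    have hzero : Tendsto (fun z => (z - lam₀) • x) (𝓝[≠] lam₀) (𝓝 0) :=
      (Continuous.tendsto' (by fun_prop) _ _ (by simp)).mono_left nhdsWithin_le_nhds
    refine tendsto_nhds_unique (hQapply hsub) (hzero.congr' ?_)
    filter_upwards [hpole.2.1] with z hz
    rw [(isResolventAt_resolvent hz).apply_sub hxa]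
  have hQe : Q (Q y) = Q y := by
    refine tendsto_nhds_unique (hQapply tendsto_const_nhds) (tendsto_const_nhds.congr' ?_)
    filter_upwards [hpole.2.1, self_mem_nhdsWithin] with z hz hne
    rw [(isResolventAt_resolvent hz).apply_eigenvector (hQA y) hne,
      smul_inv_smul₀ (sub_ne_zero.2 hne)]
  refine ⟨Q y, ψ ∘L Q, by simp [hQe, hψ], hQA y, fun x a hxa => ?_, hQeq.symm ▸ hQ⟩
  have := congrArg ψ (hQgraph x a hxa)
  rw [map_sub, map_smul, map_sub, map_smul, map_zero, sub_eq_zero] at this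
  exact this.symm

theorem IsResolventAt.addBounded_neg_smulRight {z c : ℂ} {R : X →L[ℂ] X} {φ : X →L[ℂ] ℂ} {e : X}
    (hR : IsResolventAt A z R) (hφe : φ e = 1) (he : (e, lam₀ • e) ∈ A.graph)
    (hφ : ∀ x a, (x, a) ∈ A.graph → φ a = lam₀ * φ x) (hz : z ≠ lam₀) (hc : z - lam₀ + c ≠ 0) :
    IsResolventAt (addBounded A (-((c • φ).smulRight e))) z
      (R - ((z - lam₀)⁻¹ * (c / (z - lam₀ + c))) • φ.smulRight e) := by
  have hz' : z - lam₀ ≠ 0 := sub_ne_zero.2 hz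
  have hRe : R e = (z - lam₀)⁻¹ • e := hR.apply_eigenvector he hz
  have hφR : ∀ y, φ (R y) = (z - lam₀)⁻¹ * φ y := fun y => by
    have := hφ _ _ (hR.apply_mem_graph y)
    rw [map_sub, map_smul, smul_eq_mul] at this
    field_simp
    linear_combination this
  have hφRe : (-(c • φ)) (R e) = -(c * (z - lam₀)⁻¹) := by
    rw [neg_apply, smul_apply, hφR, hφe, mul_one, smul_eq_mul]
  have hone : 1 - -(c * (z - lam₀)⁻¹) = (z - lam₀ + c) * (z - lam₀)⁻¹ := by field_simp; ring
  have hne : (-(c • φ)) (R e) ≠ 1 := by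
    rw [hφRe, ne_comm, ← sub_ne_zero, hone]
    exact mul_ne_zero hc (inv_ne_zero hz')
  convert hR.addBounded_smulRight hne using 1
  · congr 1
    ext x
    simp
  · rw [hφRe, hone, hRe]
    ext y
    simp only [sub_apply, add_apply, smul_apply, neg_apply, ContinuousLinearMap.smulRight_apply,
      ContinuousLinearMap.comp_apply, hφR, smul_eq_mul, smul_smul, sub_eq_add_neg (R y), ← neg_smul]
    congr 2
    field_simp

theorem exists_isDeflation [CompleteSpace X] (hpole : IsResolventPole A lam₀)
    (hsimple : IsAlgSimple A lam₀) (hr : 0 < r) (hiso : closedBall lam₀ r ∩ spec A = {lam₀}) :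
    ∃ e φ, IsDeflation A lam₀ r e φ := by
  obtain ⟨e, φ, hφe, he, hφ, hlim⟩ := hpole.exists_rankOne_residue hsimple
  have hc0 : (r + 1 : ℂ) ≠ 0 := by exact_mod_cast (by positivity : r + 1 ≠ 0)
  set A' := addBounded A (-(((r + 1 : ℂ) • φ).smulRight e))
  have hres : ∀ z ∈ closedBall lam₀ r, z ≠ lam₀ → IsResolventAt A' z (resolvent A z -
      ((z - lam₀)⁻¹ * ((r + 1) / (z - lam₀ + (r + 1)))) • φ.smulRight e) := by
    intro z hz hne
    have hzA : z ∈ resolventSet A := by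
      by_contra hzA
      exact hne (hiso.subset ⟨hz, hzA⟩)
    refine (isResolventAt_resolvent hzA).addBounded_neg_smulRight hφe he hφ hne fun h0 => ?_
    have hnorm : ‖z - lam₀‖ = r + 1 := by
      rw [eq_neg_of_add_eq_zero_left h0, norm_neg]
      exact_mod_cast abs_of_pos (by positivity : 0 < r + 1)
    exact absurd (mem_closedBall_iff_norm.1 hz) (by linarith)
  have hball : ∀ᶠ z in 𝓝[≠] lam₀, z ∈ closedBall lam₀ r ∧ z ≠ lam₀ :=
    (eventually_nhdsWithin_of_eventually_nhds (closedBall_mem_nhds lam₀ hr)).and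
      self_mem_nhdsWithin
  have hlim' : Tendsto (fun z => (z - lam₀) • resolvent A' z) (𝓝[≠] lam₀) (𝓝 0) := by
    have hcoef : Tendsto (fun z : ℂ => (r + 1) / (z - lam₀ + (r + 1))) (𝓝[≠] lam₀) (𝓝 1) := by
      refine Tendsto.mono_left ?_ nhdsWithin_le_nhds
      have : ContinuousAt (fun z : ℂ => (r + 1) / (z - lam₀ + (r + 1))) lam₀ := by
        fun_prop (disch := simpa using hc0)
      simpa [hc0] using this.tendsto
    have := hlim.sub (hcoef.smul_const (φ.smulRight e))
    rw [one_smul, sub_self] at this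
    refine this.congr' (hball.mono fun z hz => ?_)
    beta_reduce
    rw [(hres z hz.1 hz.2).resolvent_eq, smul_sub, smul_smul,
      mul_inv_cancel_left₀ (sub_ne_zero.2 hz.2)]
  refine ⟨e, (r + 1 : ℂ) • φ, he, by simpa [hφe] using hc0, fun z hz => ?_⟩
  rcases eq_or_ne z lam₀ with rfl | hne
  · have hsmall : ∀ᶠ w in 𝓝[≠] z, ‖(w - z) • resolvent A' w‖ < 1 :=
      hlim'.norm.eventually_lt_const (by simp)
    obtain ⟨w, hw, hwA⟩ := (hsmall.and hball).exists
    exact mem_resolventSet_of_norm_smul_lt_one ⟨_, hres w hwA.1 hwA.2⟩ hw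
  · exact ⟨_, hres z hz hne⟩

end Deflation

open scoped ContDiff

section RankOneSpectrum

variable {X : Type*} [NormedAddCommGroup X] [NormedSpace ℂ X]
  {G : X →ₗ.[ℂ] X} {φ : X →L[ℂ] ℂ} {e : X} {U : Set ℂ} {μ : ℂ}

theorem spec_addBounded_smulRight_inter (hG : U ⊆ resolventSet G) (hμU : μ ∈ U)
    (hμ : φ (resolvent G μ e) = 1)
    (hne : ∀ z ∈ U, φ (resolvent G z (resolvent G μ e)) ≠ 0) :
    spec (addBounded G (φ.smulRight e)) ∩ U = {μ} := by
  have hRμ := isResolventAt_resolvent (hG hμU)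
  refine Subset.antisymm ?_ ?_
  · rintro z ⟨hz, hzU⟩
    by_contra hzμ
    exact hz ⟨_, (isResolventAt_resolvent (hG hzU)).addBounded_smulRight_of_eq_one hRμ hμ hzμ
      (hne z hzU)⟩
  · rintro z rfl
    refine ⟨mem_spec_of_mem_graph (hRμ.mem_graph_addBounded_smulRight hμ) fun h0 => ?_, hμU⟩
    simp [h0] at hμ

theorem addBounded_smulRight_isResolventPole_and_isSpectralProjection [CompleteSpace X]
    (hU : U ∈ 𝓝 μ) (hG : U ⊆ resolventSet G) (hμ : φ (resolvent G μ e) = 1)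
    (hne : ∀ z ∈ U, φ (resolvent G z (resolvent G μ e)) ≠ 0) :
    IsResolventPole (addBounded G (φ.smulRight e)) μ ∧
      IsSpectralProjection (addBounded G (φ.smulRight e)) μ
        (((φ (resolvent G μ (resolvent G μ e)))⁻¹ • (φ ∘L resolvent G μ)).smulRight
          (resolvent G μ e)) := by
  have hμU : μ ∈ U := mem_of_mem_nhds hU
  have hspec : μ ∈ spec (addBounded G (φ.smulRight e)) :=
    (spec_addBounded_smulRight_inter hG hμU hμ hne).superset rfl |>.1
  set F : ℂ → X →L[ℂ] X := fun z => (z - μ) • resolvent G z +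
    (φ (resolvent G z (resolvent G μ e)))⁻¹ • (φ ∘L resolvent G z).smulRight (resolvent G z e)
    with hF
  have hFμ : F μ = ((φ (resolvent G μ (resolvent G μ e)))⁻¹ • (φ ∘L resolvent G μ)).smulRight
      (resolvent G μ e) := by
    ext x
    simp [hF, mul_smul]
  have hFan : AnalyticAt ℂ F μ := by
    have hR : ContDiffAt ℂ ω (resolvent G) μ := (analyticAt_resolvent (hG hμU)).contDiffAt
    have hne := hne μ hμU
    exact ContDiffAt.analyticAt (by fun_prop (disch := assumption))
  have hF0 : F μ ≠ 0 := fun h0 => by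
    have := congrArg φ (DFunLike.congr_fun (hFμ.symm.trans h0) (resolvent G μ e))
    simp [hμ, hne μ hμU] at this
  have hres : ∀ᶠ z in 𝓝[≠] μ,
      IsResolventAt (addBounded G (φ.smulRight e)) z ((z - μ)⁻¹ • F z) := by
    filter_upwards [nhdsWithin_le_nhds hU, self_mem_nhdsWithin] with z hzU hz
    exact (isResolventAt_resolvent (hG hzU)).addBounded_smulRight_of_eq_one
      (isResolventAt_resolvent (hG hμU)) hμ hz (hne z hzU)
  exact ⟨isResolventPole_of_eventually_isResolventAt hspec hFan hF0 hres,
    hFμ ▸ isSpectralProjection_of_eventually_isResolventAt hspec hFan hres⟩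

end RankOneSpectrum

/-! ### Relatively bounded perturbations -/

section RelativelyBounded

variable {X : Type*} [NormedAddCommGroup X] [NormedSpace ℂ X] {A B : X →ₗ.[ℂ] X} {z₀ z : ℂ}
  {C : X →L[ℂ] X}

/-- The operator `(1 - B R(z, A))⁻¹` for `B = C (z₀ - A)`, as a function of the pair `(C, z)`; here
`(z₀ - A) R(z, A)` is written as `1 + (z₀ - z) R(z, A)`. -/
noncomputable def neumannFactor (A : X →ₗ.[ℂ] X) (z₀ : ℂ) (p : (X →L[ℂ] X) × ℂ) : X →L[ℂ] X :=
  Ring.inverse (1 - p.1 * (1 + (z₀ - p.2) • resolvent A p.2))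

/-- The resolvent of `A + B` at `z` for `B = C (z₀ - A)`, as a function of the pair `(C, z)`. -/
noncomputable def perturbedResolvent (A : X →ₗ.[ℂ] X) (z₀ : ℂ) (p : (X →L[ℂ] X) × ℂ) : X →L[ℂ] X :=
  resolvent A p.2 * neumannFactor A z₀ p

theorem FactorsThrough.isResolventAt_add (hB : FactorsThrough A B z₀ C)
    (hz : z ∈ resolventSet A) (hC : IsUnit (1 - C * (1 + (z₀ - z) • resolvent A z))) :
    IsResolventAt (A + B) z (perturbedResolvent A z₀ (C, z)) := by
  have hR := isResolventAt_resolvent hz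
  refine hR.mul_inverse hC fun x y => hB.mem_graph_add_iff.trans
    (exists_congr fun a => and_congr_right fun hxa => ?_)
  have hshift : (1 + (z₀ - z) • resolvent A z) (z • x - a) = z₀ • x - a := by
    rw [add_apply, smul_apply, hR.apply_sub hxa, one_apply_eq_self, sub_smul]
    abel
  rw [sub_apply, one_apply_eq_self, mul_apply_eq_comp, hshift, sub_sub, sub_right_inj]

theorem FactorsThrough.mem_graph (hB : FactorsThrough A B z₀ C) (hz : z ∈ resolventSet A)
    (hC : IsUnit (1 - C * (1 + (z₀ - z) • resolvent A z))) (y : X) :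
    (perturbedResolvent A z₀ (C, z) y, neumannFactor A z₀ (C, z) y - y) ∈ B.graph := by
  have hinv : (1 - C * (1 + (z₀ - z) • resolvent A z)) (neumannFactor A z₀ (C, z) y) = y :=
    DFunLike.congr_fun (Ring.mul_inverse_cancel _ hC) y
  change (resolvent A z (neumannFactor A z₀ (C, z) y), _) ∈ B.graph
  convert hB _ _ ((isResolventAt_resolvent hz).apply_mem_graph (neumannFactor A z₀ (C, z) y))
    using 2
  rw [sub_apply, one_apply_eq_self, mul_apply_eq_comp, sub_eq_iff_eq_add', ← sub_eq_iff_eq_add]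
    at hinv
  rw [hinv, add_apply, smul_apply, one_apply_eq_self, sub_smul]
  congr 1
  abel

theorem contDiffAt_neumannFactor [CompleteSpace X] (hz : z ∈ resolventSet A)
    (hC : IsUnit (1 - C * (1 + (z₀ - z) • resolvent A z))) :
    ContDiffAt ℂ ω (neumannFactor A z₀) (C, z) := by
  obtain ⟨D, hD⟩ := hC
  have hR : ContDiffAt ℂ ω (fun p : (X →L[ℂ] X) × ℂ => resolvent A p.2) (C, z) :=
    ContDiffAt.comp (C, z) (analyticAt_resolvent hz).contDiffAt contDiffAt_snd
  refine ContDiffAt.comp (C, z) (g := Ring.inverse)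
    (f := fun p => 1 - p.1 * (1 + (z₀ - p.2) • resolvent A p.2))
    (hD ▸ contDiffAt_ringInverse ℂ D) ?_
  exact contDiffAt_const.sub (contDiffAt_fst.mul (contDiffAt_const.add
    ((contDiffAt_const.sub contDiffAt_snd).smul hR)))

theorem neumannFactor_zero : neumannFactor A z₀ (0, z) = 1 := by
  rw [neumannFactor, zero_mul, sub_zero, Ring.inverse_one]

theorem perturbedResolvent_zero : perturbedResolvent A z₀ (0, z) = resolvent A z := by
  rw [perturbedResolvent, neumannFactor_zero, mul_one]

theorem contDiffAt_perturbedResolvent [CompleteSpace X] (hz : z ∈ resolventSet A)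
    (hC : IsUnit (1 - C * (1 + (z₀ - z) • resolvent A z))) :
    ContDiffAt ℂ ω (perturbedResolvent A z₀) (C, z) :=
  ContDiffAt.mul (ContDiffAt.comp (C, z) (analyticAt_resolvent hz).contDiffAt contDiffAt_snd)
    (contDiffAt_neumannFactor hz hC)

theorem addBounded_add (A B : X →ₗ.[ℂ] X) (L : X →L[ℂ] X) :
    addBounded A L + B = addBounded (A + B) L :=
  LinearPMap.eq_of_eq_graph <| by
    ext ⟨x, y⟩
    rw [mem_graph_addBounded, mk_mem_graph_iff, mk_mem_graph_iff]
    refine exists_congr fun h => ?_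
    rw [eq_sub_iff_add_eq']
    change L x + A ⟨x, h.1⟩ + B ⟨x, h.2⟩ = y ↔ L x + (A ⟨x, h.1⟩ + B ⟨x, h.2⟩) = y
    rw [add_assoc]

theorem mem_graph_of_mem_graph_add {x y w : X} (hxy : (x, y) ∈ (A + B).graph)
    (hxw : (x, w) ∈ B.graph) : (x, y - w) ∈ A.graph := by
  obtain ⟨h, rfl⟩ := mk_mem_graph_iff.1 hxy
  obtain ⟨hB, rfl⟩ := mk_mem_graph_iff.1 hxw
  refine mk_mem_graph_iff.2 ⟨h.1, ?_⟩
  rw [eq_sub_iff_add_eq]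
  rfl

end RelativelyBounded

section Kato

theorem exists_implicit_function {E : Type*} [NormedAddCommGroup E] [NormedSpace ℂ E]
    [CompleteSpace E] {f : E × ℂ → ℂ} {x₀ : E} {z₀ : ℂ} (hf : ContDiffAt ℂ ω f (x₀, z₀))
    (hderiv : deriv (fun z => f (x₀, z)) z₀ ≠ 0) :
    ∃ g : E → ℂ, g x₀ = z₀ ∧ ContDiffAt ℂ ω g x₀ ∧ ∀ᶠ x in 𝓝 x₀, f (x, g x) = f (x₀, z₀) := by
  have hpartial : (fderiv ℂ f (x₀, z₀) ∘L .inr ℂ E ℂ) 1 = deriv (fun z => f (x₀, z)) z₀ := by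
    have hcomp : HasDerivAt (fun z => f (x₀, z)) (fderiv ℂ f (x₀, z₀) (0, 1)) z₀ :=
      (hf.differentiableAt (by simp)).hasFDerivAt.comp_hasDerivAt z₀
        ((hasDerivAt_const z₀ x₀).prodMk (hasDerivAt_id z₀))
    exact hcomp.deriv.symm
  have hinv : (fderiv ℂ f (x₀, z₀) ∘L .inr ℂ E ℂ).IsInvertible := by
    refine ⟨ContinuousLinearEquiv.unitsEquivAut ℂ (Units.mk0 _ (hpartial ▸ hderiv)), ?_⟩
    ext
    simp
  exact ⟨hf.implicitFunction (by simp) hinv, hf.implicitFunction_apply_self _ hinv,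
    hf.contDiffAt_implicitFunction _ hinv, hf.eventually_apply_implicitFunction _ hinv⟩

variable {X : Type*} [NormedAddCommGroup X] [NormedSpace ℂ X]
  {A : X →ₗ.[ℂ] X} {lam₀ : ℂ} {r : ℝ} {e : X} {φ : X →L[ℂ] ℂ}

namespace IsDeflation

theorem sub_add_ne_zero (h : IsDeflation A lam₀ r e φ) {z : ℂ} (hz : z ∈ closedBall lam₀ r) :
    z - lam₀ + φ e ≠ 0 := by
  intro h0
  have heig : (e, z • e) ∈ (addBounded A (-(φ.smulRight e))).graph := by
    rw [mem_graph_addBounded, neg_apply, ContinuousLinearMap.smulRight_apply, sub_neg_eq_add,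
      ← add_smul, (by linear_combination h0 : z + φ e = lam₀)]
    exact h.eigenvector
  refine mem_spec_of_mem_graph heig (fun he => h.apply_ne_zero ?_) (h.subset_resolventSet hz)
  rw [he, map_zero]

theorem resolvent_apply (h : IsDeflation A lam₀ r e φ) {z : ℂ} (hz : z ∈ closedBall lam₀ r) :
    resolvent (addBounded A (-(φ.smulRight e))) z e = (z - lam₀ + φ e)⁻¹ • e := by
  have heig : (e, (lam₀ - φ e) • e) ∈ (addBounded A (-(φ.smulRight e))).graph := by
    rw [mem_graph_addBounded, neg_apply, ContinuousLinearMap.smulRight_apply, sub_neg_eq_add,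
      ← add_smul, sub_add_cancel]
    exact h.eigenvector
  have hne := h.sub_add_ne_zero hz
  rw [(isResolventAt_resolvent (h.subset_resolventSet hz)).apply_eigenvector heig
    (sub_ne_zero.1 (by rwa [sub_sub_eq_add_sub, add_sub_right_comm])), sub_sub_eq_add_sub,
    add_sub_right_comm]

end IsDeflation

/-- Spectral data of the perturbed operator `A + B` near `lam₀`: the only spectral value in the disc
`|z - lam₀| < r` is the simple eigenvalue `lam`, with eigenvector `u` and spectral projection
`x ↦ ψ(x) u`; moreover `w = B u`. -/
structure IsSimpleEigendata (A B : X →ₗ.[ℂ] X) (lam₀ : ℂ) (r : ℝ) (lam : ℂ) (u w : X)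
    (ψ : X →L[ℂ] ℂ) : Prop where
  spec_inter : spec (A + B) ∩ ball lam₀ r = {lam}
  isResolventPole : IsResolventPole (A + B) lam
  isAlgSimple : IsAlgSimple (A + B) lam
  isSpectralProjection : IsSpectralProjection (A + B) lam (ψ.smulRight u)
  mem_graph : (u, lam • u - w) ∈ A.graph
  mem_graph_perturbation : (u, w) ∈ B.graph

variable [CompleteSpace X]

theorem FactorsThrough.isSimpleEigendata {G B : X →ₗ.[ℂ] X} {z₀ lam : ℂ} {C : X →L[ℂ] X}
    (hB : FactorsThrough G B z₀ C) (hG : ball lam₀ r ⊆ resolventSet G)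
    (hC : ∀ z ∈ ball lam₀ r, IsUnit (1 - C * (1 + (z₀ - z) • resolvent G z)))
    (hlam : lam ∈ ball lam₀ r) (hφ : φ (perturbedResolvent G z₀ (C, lam) e) = 1)
    (hne : ∀ z ∈ ball lam₀ r,
      φ (perturbedResolvent G z₀ (C, z) (perturbedResolvent G z₀ (C, lam) e)) ≠ 0) :
    IsSimpleEigendata (addBounded G (φ.smulRight e)) B lam₀ r lam
      (perturbedResolvent G z₀ (C, lam) e) (neumannFactor G z₀ (C, lam) e - e)
      ((φ (perturbedResolvent G z₀ (C, lam) (perturbedResolvent G z₀ (C, lam) e)))⁻¹ •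
        (φ ∘L perturbedResolvent G z₀ (C, lam))) := by
  have hres : ∀ z ∈ ball lam₀ r, IsResolventAt (G + B) z (perturbedResolvent G z₀ (C, z)) :=
    fun z hz => hB.isResolventAt_add (hG hz) (hC z hz)
  have hGB : ball lam₀ r ⊆ resolventSet (G + B) := fun z hz => ⟨_, hres z hz⟩
  have hφ' : φ (resolvent (G + B) lam e) = 1 := by rwa [(hres lam hlam).resolvent_eq]
  have hne' : ∀ z ∈ ball lam₀ r, φ (resolvent (G + B) z (resolvent (G + B) lam e)) ≠ 0 := by
    intro z hz
    rw [(hres z hz).resolvent_eq, (hres lam hlam).resolvent_eq]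
    exact hne z hz
  have hpole := addBounded_smulRight_isResolventPole_and_isSpectralProjection
    (isOpen_ball.mem_nhds hlam) hGB hφ' hne'
  have hgraph := (hres lam hlam).mem_graph_addBounded_smulRight hφ
  have hBgraph := hB.mem_graph (hG hlam) (hC lam hlam) e
  rw [(hres lam hlam).resolvent_eq] at hpole
  rw [← addBounded_add] at hpole hgraph
  exact {
    spec_inter := addBounded_add G B _ ▸ spec_addBounded_smulRight_inter hGB hlam hφ' hne'
    isResolventPole := hpole.1
    isAlgSimple := addBounded_add G B _ ▸
      (hres lam hlam).isAlgSimple_addBounded_smulRight hφ (hne lam hlam)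
    isSpectralProjection := hpole.2
    mem_graph := mem_graph_of_mem_graph_add hgraph hBgraph
    mem_graph_perturbation := hBgraph }

theorem eventually_forall_isUnit {G : X →ₗ.[ℂ] X} {K : Set ℂ} (hK : IsCompact K)
    (hG : K ⊆ resolventSet G) (z₀ : ℂ) :
    ∀ᶠ C : X →L[ℂ] X in 𝓝 0, ∀ z ∈ K, IsUnit (1 - C * (1 + (z₀ - z) • resolvent G z)) := by
  refine hK.eventually_forall_of_forall_eventually fun z hz => ?_
  have hR : ContinuousAt (fun p : (X →L[ℂ] X) × ℂ => resolvent G p.2) (0, z) :=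
    ContinuousAt.comp (g := resolvent G) (f := Prod.snd) (x := ((0 : X →L[ℂ] X), z))
      (analyticAt_resolvent (hG hz)).continuousAt continuousAt_snd
  have hcont : ContinuousAt (fun p : (X →L[ℂ] X) × ℂ =>
      1 - p.1 * (1 + (z₀ - p.2) • resolvent G p.2)) (0, z) := by fun_prop
  exact hcont.eventually_mem (Units.isOpen.mem_nhds ⟨1, by simp⟩)

theorem IsDeflation.exists_simpleEigenvalue (h : IsDeflation A lam₀ r e φ) (hr : 0 < r)
    {Q : (X →L[ℂ] X) × ℂ → X →L[ℂ] X}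
    (hQ : Q = perturbedResolvent (addBounded A (-(φ.smulRight e))) lam₀) :
    ∃ Λ : (X →L[ℂ] X) → ℂ, ContDiffAt ℂ ω Λ 0 ∧ Λ 0 = lam₀ ∧
      ∀ᶠ C in 𝓝 0, φ (Q (C, Λ C) e) = 1 ∧
        ∀ z ∈ closedBall lam₀ r, φ (Q (C, z) (Q (C, Λ C) e)) ≠ 0 := by
  set A' := addBounded A (-(φ.smulRight e))
  have hlam₀ : lam₀ ∈ closedBall lam₀ r := mem_closedBall_self hr.le
  have hQ0 : ∀ z ∈ closedBall lam₀ r, Q (0, z) e = (z - lam₀ + φ e)⁻¹ • e := fun z hz => by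
    rw [hQ, perturbedResolvent_zero, h.resolvent_apply hz]
  have hQdiff : ∀ z ∈ closedBall lam₀ r, ContDiffAt ℂ ω Q (0, z) := fun z hz =>
    hQ ▸ contDiffAt_perturbedResolvent (h.subset_resolventSet hz) (by simp)
  have hone : φ (Q (0, lam₀) e) = 1 := by
    simp [hQ0 lam₀ hlam₀, h.apply_ne_zero]
  have hderiv : deriv (fun z => φ (Q (0, z) e)) lam₀ ≠ 0 := by
    have hφe := h.apply_ne_zero
    have hrat : HasDerivAt (fun z => (z - lam₀ + φ e)⁻¹ * φ e)
        (-1 / (lam₀ - lam₀ + φ e) ^ 2 * φ e) lam₀ :=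
      ((((hasDerivAt_id lam₀).sub_const lam₀).add_const (φ e)).fun_inv
        (by simpa using hφe)).mul_const (φ e)
    have heq : (fun z => φ (Q (0, z) e)) =ᶠ[𝓝 lam₀] fun z => (z - lam₀ + φ e)⁻¹ * φ e := by
      filter_upwards [closedBall_mem_nhds lam₀ hr] with z hz
      rw [hQ0 z hz, map_smul, smul_eq_mul]
    rw [heq.deriv_eq, hrat.deriv]
    simp [hφe]
  have hlam₀diff := hQdiff lam₀ hlam₀
  obtain ⟨Λ, hΛ0, hΛ, hΛeq⟩ := exists_implicit_function (f := fun p => φ (Q p e)) (x₀ := 0)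
    (z₀ := lam₀) (by fun_prop) hderiv
  refine ⟨Λ, hΛ, hΛ0, (hone ▸ hΛeq).and ?_⟩
  refine (isCompact_closedBall lam₀ r).eventually_forall_of_forall_eventually fun z hz => ?_
  have hcont : ContinuousAt (fun p : (X →L[ℂ] X) × ℂ => φ (Q p (Q (p.1, Λ p.1) e))) (0, z) := by
    have hQΛ : ContinuousAt (fun p : (X →L[ℂ] X) × ℂ => Q (p.1, Λ p.1)) (0, z) :=
      ContinuousAt.comp (g := Q) (by simpa only [hΛ0] using hlam₀diff.continuousAt)
        (continuousAt_fst.prodMk (ContinuousAt.comp hΛ.continuousAt continuousAt_fst))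
    exact φ.continuous.continuousAt.comp
      ((hQdiff z hz).continuousAt.clm_apply (hQΛ.clm_apply continuousAt_const))
  refine hcont.eventually_ne ?_
  simp only [hΛ0, hQ0 lam₀ hlam₀, map_smul, hQ0 z hz, sub_self, zero_add, smul_eq_mul]
  exact mul_ne_zero (inv_ne_zero h.apply_ne_zero)
    (mul_ne_zero (inv_ne_zero (h.sub_add_ne_zero hz)) h.apply_ne_zero)

theorem IsDeflation.exists_isSimpleEigendata (h : IsDeflation A lam₀ r e φ) (hr : 0 < r) :
    ∃ (Λ : (X →L[ℂ] X) → ℂ) (u w : (X →L[ℂ] X) → X) (ψ : (X →L[ℂ] X) → X →L[ℂ] ℂ),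
      ∀ᶠ C in 𝓝 0, DifferentiableAt ℂ Λ C ∧ DifferentiableAt ℂ u C ∧ DifferentiableAt ℂ w C ∧
        DifferentiableAt ℂ ψ C ∧ ∀ B, FactorsThrough (addBounded A (-(φ.smulRight e))) B lam₀ C →
          IsSimpleEigendata A B lam₀ r (Λ C) (u C) (w C) (ψ C) := by
  set A' := addBounded A (-(φ.smulRight e)) with hA'
  set Q := perturbedResolvent A' lam₀ with hQ
  obtain ⟨Λ, hΛ, hΛ0, hev⟩ := h.exists_simpleEigenvalue hr hQ
  have hΛball : ∀ᶠ C in 𝓝 0, Λ C ∈ ball lam₀ r :=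
    hΛ.continuousAt.eventually_mem (isOpen_ball.mem_nhds (hΛ0 ▸ mem_ball_self hr))
  refine ⟨Λ, fun C => Q (C, Λ C) e, fun C => neumannFactor A' lam₀ (C, Λ C) e - e,
    fun C => (φ (Q (C, Λ C) (Q (C, Λ C) e)))⁻¹ • (φ ∘L Q (C, Λ C)), ?_⟩
  filter_upwards [hev, hΛball, hΛ.eventually (by simp),
    eventually_forall_isUnit (isCompact_closedBall lam₀ r) h.subset_resolventSet lam₀]
    with C ⟨hone, hne⟩ hball hΛC hunit
  have hΛC' : ContDiffAt ℂ ω (fun C => (C, Λ C)) C := contDiffAt_id.prodMk hΛC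
  have hball' := ball_subset_closedBall hball
  have hQΛ : ContDiffAt ℂ ω (fun C => Q (C, Λ C)) C :=
    ContDiffAt.comp (g := Q) C
      (contDiffAt_perturbedResolvent (h.subset_resolventSet hball') (hunit _ hball')) hΛC'
  have hNΛ : ContDiffAt ℂ ω (fun C => neumannFactor A' lam₀ (C, Λ C)) C :=
    ContDiffAt.comp (g := neumannFactor A' lam₀) C
      (contDiffAt_neumannFactor (h.subset_resolventSet hball') (hunit _ hball')) hΛC'
  have hψ : ContDiffAt ℂ ω
      (fun C => (φ (Q (C, Λ C) (Q (C, Λ C) e)))⁻¹ • (φ ∘L Q (C, Λ C))) C := by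
    have hφQQ := contDiffAt_const (c := φ).clm_apply (hQΛ.clm_apply (hQΛ.clm_apply
      (contDiffAt_const (c := e))))
    exact (hφQQ.inv (hne _ hball')).smul (contDiffAt_const.clm_comp hQΛ)
  refine ⟨hΛC.differentiableAt (by simp),
    (hQΛ.clm_apply contDiffAt_const).differentiableAt (by simp),
    ((hNΛ.clm_apply contDiffAt_const).sub contDiffAt_const).differentiableAt (by simp),
    hψ.differentiableAt (by simp), fun B hB => ?_⟩
  have := hB.isSimpleEigendata (φ := φ) (e := e)
    (ball_subset_closedBall.trans h.subset_resolventSet)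
    (fun z hz => hunit z (ball_subset_closedBall hz)) hball hone
    (fun z hz => hne z (ball_subset_closedBall hz))
  rwa [hA', addBounded_neg_addBounded] at this

end Kato

/-! ### Integral equations and integrals depending on a parameter -/

section Integrals

open MeasureTheory

variable {E : Type*} [NormedAddCommGroup E]

theorem continuousOn_of_forall_eq_comp_sub {Y : Type*} [TopologicalSpace Y] {I : Set ℝ}
    (hpos : I ⊆ Ioi 0) (hsub : ∀ s ∈ I, ∀ a ∈ Ioo 0 s, s - a ∈ I) {f : ℝ → Y} {g : ℝ → ℝ → Y}
    (hg : ∀ a ∈ I, ContinuousOn (g a) I) (hfg : ∀ s ∈ I, ∀ a ∈ Ioo 0 s, f s = g a (s - a)) :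
    ContinuousOn f I := by
  intro t ht
  have ht0 : 0 < t := hpos ht
  have hhalf : t - t / 2 ∈ I := hsub t ht (t / 2) ⟨by linarith, by linarith⟩
  have hmaps : MapsTo (fun s => s - t / 2) (I ∩ Ioi (t / 2)) I := fun s hs =>
    hsub s hs.1 _ ⟨by linarith, hs.2⟩
  have heq : ∀ s ∈ I ∩ Ioi (t / 2), f s = g (t / 2) (s - t / 2) := fun s hs =>
    hfg s hs.1 _ ⟨by linarith, hs.2⟩
  have hcont : ContinuousWithinAt (fun s => g (t / 2) (s - t / 2)) (I ∩ Ioi (t / 2)) t :=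
    ContinuousWithinAt.comp (g := g (t / 2)) (f := fun s => s - t / 2)
      (hg _ (sub_half t ▸ hhalf) _ hhalf) (by fun_prop) hmaps
  have htmem : t ∈ I ∩ Ioi (t / 2) := ⟨ht, half_lt_self ht0⟩
  exact (hcont.congr heq (heq t htmem)).mono_of_mem_nhdsWithin
    (inter_mem self_mem_nhdsWithin (mem_nhdsWithin_of_mem_nhds (Ioi_mem_nhds htmem.2)))

theorem intervalIntegrable_and_integral_norm_le_of_tendsto {f : ℝ → E} {g : ℝ → ℝ} {a b M : ℝ}
    (hab : a < b) (hf : ∀ ε ∈ Ioo a b, IntervalIntegrable f volume ε b)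
    (hfg : ∀ ε ∈ Ioo a b, ∫ s in ε..b, ‖f s‖ ≤ g ε) (hg : Tendsto g (𝓝[>] a) (𝓝 M)) :
    IntervalIntegrable f volume a b ∧ ∫ s in a..b, ‖f s‖ ≤ M := by
  have hint : IntegrableOn f (Ioc a b) := by
    obtain ⟨ε, -, hε, hεlim⟩ := exists_seq_strictAnti_tendsto' hab
    have hεlim' : Tendsto ε atTop (𝓝[>] a) :=
      tendsto_nhdsWithin_iff.2 ⟨hεlim, Eventually.of_forall fun n => (hε n).1⟩
    refine integrableOn_Ioc_of_intervalIntegral_norm_bounded_left (I := M + 1)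
      (fun n => (intervalIntegrable_iff_integrableOn_Ioc_of_le (hε n).2.le).1 (hf _ (hε n)))
      hεlim ?_
    filter_upwards [(hg.comp hεlim').eventually_lt_const (lt_add_one M)] with n hn
    rw [← intervalIntegral.integral_of_le (hε n).2.le]
    exact (hfg _ (hε n)).trans hn.le
  refine ⟨(intervalIntegrable_iff_integrableOn_Ioc_of_le hab.le).2 hint, ?_⟩
  have hlim : Tendsto (fun ε => ∫ s in ε..b, ‖f s‖) (𝓝[>] a) (𝓝 (∫ s in a..b, ‖f s‖)) := by
    have hcont := intervalIntegral.continuousOn_primitive_interval_left (μ := volume) (a := a)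
      (b := b) (f := fun s => ‖f s‖)
      (by rw [uIcc_of_le hab.le, integrableOn_Icc_iff_integrableOn_Ioc]; exact hint.norm)
    refine (hcont a left_mem_uIcc).mono_left ?_
    rw [uIcc_of_le hab.le, ← nhdsWithin_Ioc_eq_nhdsGT hab]
    exact nhdsWithin_mono _ Ioc_subset_Icc_self
  refine le_of_tendsto_of_tendsto hlim hg ?_
  filter_upwards [Ioo_mem_nhdsGT hab] with ε hε using hfg ε hε

theorem exists_eq_add_integral_apply [NormedSpace ℂ E] [CompleteSpace E] {L : ℝ → E →L[ℂ] E}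
    {k : ℝ → ℝ} {a b : ℝ} (hab : a ≤ b)
    (hmeas : ∀ x, AEStronglyMeasurable (fun s => L s x) (volume.restrict (Ioc a b)))
    (hL : ∀ s ∈ Ioc a b, ‖L s‖ ≤ k s) (hk : IntervalIntegrable k volume a b)
    (hk1 : ∫ s in a..b, k s < 1) (g : E) :
    ∃ x, (IntervalIntegrable (fun s => L s x) volume a b) ∧ x = g + ∫ s in a..b, L s x := by
  have hbound : ∀ x, ∀ᵐ s, s ∈ Ioc a b → ‖L s x‖ ≤ k s * ‖x‖ := fun x =>
    Eventually.of_forall fun s hs => (L s).le_of_opNorm_le (hL s hs) x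
  have hint : ∀ x, IntervalIntegrable (fun s => L s x) volume a b := fun x => by
    refine (hk.mul_const ‖x‖).mono_fun' ?_ ?_ <;> rw [uIoc_of_le hab]
    · exact hmeas x
    · exact (ae_restrict_iff' measurableSet_Ioc).2 (hbound x)
  have hk0 : 0 ≤ ∫ s in a..b, k s := by
    rw [intervalIntegral.integral_of_le hab]
    exact setIntegral_nonneg measurableSet_Ioc fun s hs => (norm_nonneg _).trans (hL s hs)
  have hcontr : ContractingWith (∫ s in a..b, k s).toNNReal fun x => g + ∫ s in a..b, L s x := by
    refine ⟨Real.toNNReal_lt_one.2 hk1, LipschitzWith.of_dist_le_mul fun x y => ?_⟩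
    rw [dist_add_left, dist_eq_norm, dist_eq_norm,
      ← intervalIntegral.integral_sub (hint x) (hint y)]
    simp only [← map_sub]
    rw [Real.coe_toNNReal _ hk0, ← intervalIntegral.integral_mul_const]
    exact intervalIntegral.norm_integral_le_of_norm_le hab (hbound _) (hk.mul_const _)
  exact ⟨hcontr.fixedPoint, hint _, hcontr.fixedPoint_isFixedPt.symm⟩

theorem differentiableAt_integral_of_dominated [NormedSpace ℂ E] [CompleteSpace E] {S : Type*}
    [MeasurableSpace S] {μ : Measure S} {F : S → ℂ → E} {g : S → ℝ} {c : ℂ} {R : ℝ} (hR : 0 < R)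
    (hmeas : ∀ z ∈ ball c R, AEStronglyMeasurable (fun s => F s z) μ)
    (hF : ∀ᵐ s ∂μ, DifferentiableOn ℂ (F s) (ball c R)) (hg : Integrable g μ)
    (hFg : ∀ᵐ s ∂μ, ∀ z ∈ ball c R, ‖F s z‖ ≤ g s) :
    DifferentiableAt ℂ (fun z => ∫ s, F s z ∂μ) c := by
  have hc : c ∈ ball c R := mem_ball_self hR
  have hderiv_meas : AEStronglyMeasurable (fun s => deriv (F s) c) μ := by
    obtain ⟨h, -, hh, hlim⟩ := exists_seq_strictAnti_tendsto' hR
    have hlim' : Tendsto (fun n => (h n : ℂ)) atTop (𝓝[≠] 0) :=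
      tendsto_nhdsWithin_iff.2 ⟨by exact_mod_cast (Complex.continuous_ofReal.tendsto 0).comp hlim,
        Eventually.of_forall fun n => Complex.ofReal_ne_zero.2 (hh n).1.ne'⟩
    have hmem : ∀ n, c + h n ∈ ball c R := fun n => by
      simpa [abs_of_pos (hh n).1] using (hh n).2
    refine aestronglyMeasurable_of_tendsto_ae atTop
      (f := fun n s => (h n : ℂ)⁻¹ • (F s (c + h n) - F s c))
      (fun n => ((hmeas _ (hmem n)).sub (hmeas c hc)).const_smul _) ?_
    filter_upwards [hF] with s hs
    exact (hasDerivAt_iff_tendsto_slope_zero.1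
      (hs.differentiableAt (isOpen_ball.mem_nhds hc)).hasDerivAt).comp hlim'
  refine (hasDerivAt_integral_of_dominated_loc_of_deriv_le (F := fun z s => F s z)
    (F' := fun z s => deriv (F s) z) (bound := fun s => g s / (R / 3))
    (ball_mem_nhds c (half_pos hR)) ?_ ?_ hderiv_meas ?_ (hg.div_const _) ?_).2.differentiableAt
  · filter_upwards [ball_mem_nhds c hR] using hmeas
  · exact hg.mono' (hmeas c hc) (hFg.mono fun s hs => hs c hc)
  · filter_upwards [hF, hFg] with s hs hsg z hz
    have hsub : closedBall z (R / 3) ⊆ ball c R :=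
      closedBall_subset_ball' (by linarith [mem_ball.1 hz])
    refine Complex.norm_deriv_le_of_forall_mem_sphere_norm_le (by positivity)
      (hs.diffContOnCl_ball hsub) fun w hw => hsg w (hsub (sphere_subset_closedBall hw))
  · filter_upwards [hF] with s hs z hz
    exact (hs.differentiableAt
      (isOpen_ball.mem_nhds (ball_subset_ball (half_le_self hR.le) hz))).hasDerivAt

theorem differentiableOn_integral_of_pointwise_bounded [NormedSpace ℂ E] [CompleteSpace E]
    {F : ℝ → ℂ → E} {U : Set ℂ} {α : ℝ} (hα : 0 ≤ α)
    (hmeas : ∀ z ∈ U, AEStronglyMeasurable (fun s => F s z) (volume.restrict (Ioc 0 1)))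
    (hF : ∀ s ∈ Ioc (0 : ℝ) 1, DifferentiableOn ℂ (F s) U)
    (hK : ∀ c ∈ U, ∃ K, ∀ᶠ z in 𝓝 c, z ∈ U ∧ ∀ s ∈ Ioc (0 : ℝ) 1, ‖F s z‖ ≤ K * s ^ (-α))
    (hbdd : ∀ z ∈ U, ∃ m, ∀ s ∈ Ioc (0 : ℝ) 1, ‖F s z‖ ≤ m) :
    DifferentiableOn ℂ (fun z => ∫ s in (0 : ℝ)..1, F s z) U := by
  intro c hc
  obtain ⟨K, hKc⟩ := hK c hc
  obtain ⟨R, hR, hRU⟩ := Metric.eventually_nhds_iff_ball.1 hKc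
  have hhalf : 2 * (R / 2) = R := mul_div_cancel₀ R two_ne_zero
  obtain ⟨M, hM⟩ := exists_forall_norm_le_mul_rpow_neg (F := F) (c := c) (ρ := R / 2) (K := K)
    (α := α) (ε := 1 / 2) (half_pos hR) hα (by norm_num)
    (fun s hs => (hF s hs).mono fun z hz => (hRU z (hhalf ▸ hz)).1)
    (fun s hs z hz => (hRU z (hhalf ▸ hz)).2 s hs) fun z hz => hbdd z (hRU z (hhalf ▸ hz)).1
  have hU : ball c (R / 2) ⊆ U := fun z hz => (hRU z (ball_subset_ball (half_le_self hR.le) hz)).1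
  have hrpow : IntegrableOn (fun s : ℝ => M * s ^ (-(1 / 2) : ℝ)) (Ioc 0 1) :=
    (intervalIntegrable_iff_integrableOn_Ioc_of_le zero_le_one).1
      ((intervalIntegral.intervalIntegrable_rpow' (by norm_num)).const_mul M)
  simp only [intervalIntegral.integral_of_le zero_le_one]
  refine (differentiableAt_integral_of_dominated (half_pos hR) (fun z hz => hmeas z (hU hz)) ?_
    hrpow ?_).differentiableWithinAt <;> rw [ae_restrict_iff' measurableSet_Ioc]
  · exact Eventually.of_forall fun s hs => (hF s hs).mono hU
  · exact Eventually.of_forall hM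

end Integrals

/-! ### Orbits of immediately differentiable semigroups -/

section Orbits

open MeasureTheory

variable {X : Type*} [NormedAddCommGroup X] [NormedSpace ℂ X] {T : ℝ → X →L[ℂ] X}
  {A B : X →ₗ.[ℂ] X} {z₀ lam : ℂ} {C : X →L[ℂ] X} {u w : X}

theorem IsC0Semigroup.apply_add (hT : IsC0Semigroup T) {s t : ℝ} (hs : 0 ≤ s) (ht : 0 ≤ t) (x : X) :
    T (s + t) x = T s (T t x) := by
  rw [hT.map_add s t hs ht, mul_apply_eq_comp]

theorem IsC0Semigroup.apply_mem_graph (hT : IsC0Semigroup T) (hA : IsGenerator T A) {x a : X}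
    (hx : (x, a) ∈ A.graph) {t : ℝ} (ht : 0 ≤ t) : (T t x, T t a) ∈ A.graph := by
  rw [hA] at hx ⊢
  refine (((T t).continuous.tendsto a).comp hx).congr' ?_
  filter_upwards [self_mem_nhdsWithin] with h hh
  have hcomm : T t (T h x) = T h (T t x) := by
    rw [← hT.apply_add ht (mem_Ioi.1 hh).le, ← hT.apply_add (mem_Ioi.1 hh).le ht, add_comm]
  simp only [Function.comp_apply, ← Complex.coe_smul, map_smul, map_sub, hcomm]

namespace IsImmediatelyDifferentiable

theorem hasDerivAt (hTd : IsImmediatelyDifferentiable T) (x : X) {t : ℝ} (ht : 0 < t) :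
    HasDerivAt (fun s => T s x) (deriv (fun s => T s x) t) t :=
  ((hTd x).differentiableAt (Ioi_mem_nhds ht)).hasDerivAt

theorem continuousOn_orbit (hTd : IsImmediatelyDifferentiable T) (hT : IsC0Semigroup T) (x : X) :
    ContinuousOn (fun t => T t x) (Ici 0) := by
  intro t ht
  rcases (mem_Ici.1 ht).eq_or_lt with rfl | ht0
  · rw [← Ioi_insert, continuousWithinAt_insert_self, ContinuousWithinAt, hT.map_zero]
    exact hT.tendsto_zero x
  · exact (hTd.hasDerivAt x ht0).continuousAt.continuousWithinAt

theorem mem_graph (hTd : IsImmediatelyDifferentiable T) (hT : IsC0Semigroup T)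
    (hA : IsGenerator T A) (x : X) {t : ℝ} (ht : 0 < t) :
    (T t x, deriv (fun s => T s x) t) ∈ A.graph := by
  rw [hA]
  refine ((hasDerivAt_iff_tendsto_slope_zero.1 (hTd.hasDerivAt x ht)).mono_left
    (nhdsWithin_mono _ fun h hh => (mem_Ioi.1 hh).ne')).congr' ?_
  filter_upwards [self_mem_nhdsWithin] with h hh
  rw [add_comm t h, hT.apply_add (mem_Ioi.1 hh).le ht.le]

theorem hasDerivAt_of_mem_graph (hTd : IsImmediatelyDifferentiable T) (hT : IsC0Semigroup T)
    (hA : IsGenerator T A) {x a : X} (hx : (x, a) ∈ A.graph) {t : ℝ} (ht : 0 < t) :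
    HasDerivAt (fun s => T s x) (T t a) t := by
  have heq : deriv (fun s => T s x) t = T t a :=
    A.mem_graph_snd_inj (hTd.mem_graph hT hA x ht) (hT.apply_mem_graph hA hx ht.le) rfl
  exact heq ▸ hTd.hasDerivAt x ht

theorem isLinearMap_val_orbit (hTd : IsImmediatelyDifferentiable T) (hT : IsC0Semigroup T)
    (hA : IsGenerator T A) (hdom : B.domain = A.domain) {t : ℝ} (ht : 0 < t) :
    IsLinearMap ℂ fun x => val B (T t x) := by
  have hmem : ∀ x, T t x ∈ B.domain := fun x =>
    hdom ▸ LinearPMap.mem_domain_of_mem_graph (hTd.mem_graph hT hA x ht)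
  have heq : (fun x => val B (T t x)) =
      B.toFun ∘ₗ (T t).toLinearMap.codRestrict B.domain hmem :=
    funext fun x => dif_pos (hmem x)
  exact heq ▸ LinearMap.isLinear _

end IsImmediatelyDifferentiable

theorem FactorsThrough.val_eq (hB : FactorsThrough A B z₀ C) {x a : X} (hx : (x, a) ∈ A.graph) :
    val B x = C (z₀ • x - a) :=
  val_eq_of_mem_graph (hB x a hx)

theorem FactorsThrough.val_orbit_of_mem_graph (hB : FactorsThrough A B z₀ C)
    (hT : IsC0Semigroup T) (hA : IsGenerator T A) {x a : X} (hx : (x, a) ∈ A.graph) {t : ℝ}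
    (ht : 0 ≤ t) : val B (T t x) = C (T t (z₀ • x - a)) := by
  rw [hB.val_eq (hT.apply_mem_graph hA hx ht), map_sub (T t), map_smul (T t)]

theorem FactorsThrough.continuousOn_val_orbit (hB : FactorsThrough A B z₀ C)
    (hTd : IsImmediatelyDifferentiable T) (hT : IsC0Semigroup T) (hA : IsGenerator T A) (x : X) :
    ContinuousOn (fun t => val B (T t x)) (Ioi 0) := by
  refine continuousOn_of_forall_eq_comp_sub (fun s hs => hs)
    (fun s _ a ha => sub_pos.2 ha.2)
    (g := fun a t => C (T t (z₀ • T a x - deriv (fun s => T s x) a)))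
    (fun a _ => C.continuous.comp_continuousOn
      ((hTd.continuousOn_orbit hT _).mono Ioi_subset_Ici_self)) fun s _ a ha => ?_
  rw [← hB.val_orbit_of_mem_graph hT hA (hTd.mem_graph hT hA x ha.1) (sub_pos.2 ha.2).le,
    ← hT.apply_add (sub_pos.2 ha.2).le ha.1.le, sub_add_cancel]

theorem CondS2.exists_integral_norm_val_orbit_le (hS2 : CondS2 T A B)
    (hB : FactorsThrough A B z₀ C) (hTd : IsImmediatelyDifferentiable T) (hT : IsC0Semigroup T)
    (hA : IsGenerator T A) :
    ∃ q ∈ Ioo (0 : ℝ) 1, ∃ t₀ > 0, ∀ x, IntervalIntegrable (fun s => val B (T s x)) volume 0 t₀ ∧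
      ∫ s in (0 : ℝ)..t₀, ‖val B (T s x)‖ ≤ q * ‖x‖ := by
  obtain ⟨q, hq, t₀, ht₀, h⟩ := hS2
  refine ⟨q, hq, t₀, ht₀, fun x => ?_⟩
  have hint : ∀ a b : ℝ, 0 < a → 0 < b →
      IntervalIntegrable (fun s => val B (T s x)) volume a b := fun a b ha hb =>
    ((hB.continuousOn_val_orbit hTd hT hA x).mono
      fun s hs => lt_of_lt_of_le (lt_min ha hb) hs.1).intervalIntegrable
  refine intervalIntegrable_and_integral_norm_le_of_tendsto ht₀ (fun ε hε => hint ε t₀ hε.1 ht₀)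
    (fun ε hε => ?_) (((hT.tendsto_zero x).norm).const_mul q)
  have hε0 : (0 : ℝ) ≤ ε := hε.1.le
  calc ∫ s in ε..t₀, ‖val B (T s x)‖
      ≤ (∫ s in ε..t₀, ‖val B (T s x)‖) + ∫ s in t₀..t₀ + ε, ‖val B (T s x)‖ :=
        le_add_of_nonneg_right
          (intervalIntegral.integral_nonneg (by linarith) fun _ _ => norm_nonneg _)
    _ = ∫ s in ε..t₀ + ε, ‖val B (T s x)‖ :=
        intervalIntegral.integral_add_adjacent_intervals (hint _ _ hε.1 ht₀).norm
          (hint _ _ ht₀ (by linarith)).norm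
    _ = ∫ s in (0 : ℝ)..t₀, ‖val B (T (s + ε) x)‖ := by
        rw [intervalIntegral.integral_comp_add_right (fun s => ‖val B (T s x)‖), zero_add]
    _ = ∫ s in (0 : ℝ)..t₀, ‖val B (T s (T ε x))‖ := by
        refine intervalIntegral.integral_congr fun s hs => ?_
        rw [uIcc_of_le ht₀.le] at hs
        rw [hT.apply_add hs.1 hε0]
    _ ≤ q * ‖T ε x‖ := h _ (LinearPMap.mem_domain_of_mem_graph (hTd.mem_graph hT hA x hε.1))

theorem norm_exp_neg_mul_le (lam : ℂ) {s t : ℝ} (hs : 0 ≤ s) (hst : s ≤ t) :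
    ‖Complex.exp (-lam * s)‖ ≤ Real.exp (‖lam‖ * t) := by
  refine (Complex.norm_exp_le_exp_norm _).trans (Real.exp_le_exp.2 ?_)
  rw [norm_mul, norm_neg, Complex.norm_real, Real.norm_of_nonneg hs]
  gcongr

variable [CompleteSpace X]

theorem eq_exp_smul_add_integral_of_hasDerivAt {f h : ℝ → X} {t : ℝ} (ht : 0 ≤ t)
    (hf : ContinuousOn f (Icc 0 t)) (hf' : ∀ s ∈ Ioo 0 t, HasDerivAt f (lam • f s - h s) s)
    (hh : IntervalIntegrable h volume 0 t) :
    f 0 = Complex.exp (-lam * t) • f t + ∫ s in (0 : ℝ)..t, Complex.exp (-lam * s) • h s := by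
  have hexp : ∀ s : ℝ, HasDerivAt (fun s : ℝ => Complex.exp (-lam * s))
      (Complex.exp (-lam * s) * -lam) s := fun s => by
    simpa using ((Complex.ofRealCLM.hasDerivAt (x := s)).const_mul (-lam)).cexp
  have hderiv : ∀ s ∈ Ioo 0 t, HasDerivAt (fun s : ℝ => Complex.exp (-lam * s) • f s)
      (-(Complex.exp (-lam * s) • h s)) s := fun s hs =>
    ((hexp s).smul (hf' s hs)).congr_deriv (by module)
  have hftc := intervalIntegral.integral_eq_sub_of_hasDerivAt_of_le ht
    (ContinuousOn.fun_smul (by fun_prop) hf) hderiv (hh.continuousOn_smul (by fun_prop)).neg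
  rw [intervalIntegral.integral_neg, neg_eq_iff_eq_neg, neg_sub] at hftc
  rw [hftc]
  simp

theorem eigenvector_eq_add_integral_orbit (hTd : IsImmediatelyDifferentiable T)
    (hT : IsC0Semigroup T) (hA : IsGenerator T A) (hu : (u, lam • u - w) ∈ A.graph) {t : ℝ}
    (ht : 0 ≤ t) :
    u = Complex.exp (-lam * t) • T t u + ∫ s in (0 : ℝ)..t, Complex.exp (-lam * s) • T s w := by
  have hcont : ∀ x, ContinuousOn (fun s => T s x) (Icc 0 t) := fun x =>
    (hTd.continuousOn_orbit hT x).mono Icc_subset_Ici_self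
  have hderiv : ∀ s ∈ Ioo 0 t, HasDerivAt (fun s => T s u) (lam • T s u - T s w) s := fun s hs => by
    simpa only [map_sub, map_smul] using hTd.hasDerivAt_of_mem_graph hT hA hu hs.1
  have h := eq_exp_smul_add_integral_of_hasDerivAt ht (hcont u) hderiv
    ((hcont w).intervalIntegrable_of_Icc ht)
  rwa [hT.map_zero, one_apply_eq_self] at h

theorem source_eq_add_integral_val_orbit (hTd : IsImmediatelyDifferentiable T)
    (hT : IsC0Semigroup T) (hA : IsGenerator T A) (hB : FactorsThrough A B z₀ C)
    (hu : (u, lam • u - w) ∈ A.graph) (hw : (u, w) ∈ B.graph) {t : ℝ} (ht : 0 ≤ t)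
    (hint : IntervalIntegrable (fun s => val B (T s w)) volume 0 t) :
    w = Complex.exp (-lam * t) • val B (T t u) +
      ∫ s in (0 : ℝ)..t, Complex.exp (-lam * s) • val B (T s w) := by
  have horbit : ∀ s, 0 ≤ s → val B (T s u) = C ((z₀ - lam) • T s u + T s w) := fun s hs => by
    rw [hB.val_orbit_of_mem_graph hT hA hu hs,
      (by module : z₀ • u - (lam • u - w) = (z₀ - lam) • u + w), map_add (T s), map_smul (T s)]
  have hcont : ContinuousOn (fun s => C ((z₀ - lam) • T s u + T s w)) (Icc 0 t) :=
    (C.continuous.comp_continuousOn (((hTd.continuousOn_orbit hT u).const_smul _).add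
      (hTd.continuousOn_orbit hT w))).mono Icc_subset_Ici_self
  have hderiv : ∀ s ∈ Ioo 0 t, HasDerivAt (fun s => C ((z₀ - lam) • T s u + T s w))
      (lam • C ((z₀ - lam) • T s u + T s w) - val B (T s w)) s := fun s hs => by
    refine ((C.restrictScalars ℝ).hasFDerivAt.comp_hasDerivAt s
      (((hTd.hasDerivAt_of_mem_graph hT hA hu hs.1).const_smul (z₀ - lam)).add
        (hTd.hasDerivAt w hs.1))).congr_deriv ?_
    rw [hB.val_eq (hTd.mem_graph hT hA w hs.1), ContinuousLinearMap.coe_restrictScalars',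
      ← map_smul C, ← map_sub C]
    congr 1
    simp only [map_sub, map_smul]
    module
  have h := eq_exp_smul_add_integral_of_hasDerivAt ht hcont hderiv hint
  rwa [← horbit t ht, ← horbit 0 le_rfl, hT.map_zero, one_apply_eq_self,
    val_eq_of_mem_graph hw] at h

end Orbits

/-! ### Eigenvectors in the embedded space -/

section Embedded

open MeasureTheory

variable {X V : Type*} [NormedAddCommGroup X] [NormedSpace ℂ X]
  [NormedAddCommGroup V] [NormedSpace ℂ V]
  {ι : V →L[ℂ] X} {T : ℝ → X →L[ℂ] X} {A B : X →ₗ.[ℂ] X} {z₀ lam : ℂ} {C R : X →L[ℂ] X}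
  {S : ℝ → X →L[ℂ] V} {L : ℝ → V →L[ℂ] V} {u w : X}

theorem exists_continuousLinearMap_lift {E : Type*} [NormedAddCommGroup E] [NormedSpace ℂ E]
    {f : E → X} {k : ℝ} (hι : Function.Injective ι) (hf : IsLinearMap ℂ f) (hk : 0 ≤ k)
    (h : ∀ x, ∃ v, ι v = f x ∧ ‖v‖ ≤ k * ‖x‖) :
    ∃ g : E →L[ℂ] V, ‖g‖ ≤ k ∧ ∀ x, ι (g x) = f x := by
  choose g hg hgk using h
  let gₗ : E →ₗ[ℂ] V :=
    { toFun := g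
      map_add' := fun x y => hι (by simp only [map_add, hg, hf.map_add])
      map_smul' := fun c x => hι (by simp only [map_smul, hg, hf.map_smul, RingHom.id_apply]) }
  exact ⟨gₗ.mkContinuous k hgk, gₗ.mkContinuous_norm_le hk hgk, hg⟩

theorem CondS1.exists_lift (hS1 : CondS1 ι T) (hι : Function.Injective ι) :
    ∃ (S : ℝ → X →L[ℂ] V) (K α : ℝ), 0 ≤ K ∧ 0 ≤ α ∧ ∀ s ∈ Ioc (0 : ℝ) 1,
      ‖S s‖ ≤ K * s ^ (-α) ∧ ∀ x, ι (S s x) = T s x := by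
  obtain ⟨K, α, hK, hα, h⟩ := hS1
  have hK0 : 0 ≤ K := zero_le_one.trans hK
  choose! S hS using fun (s : ℝ) (hs : s ∈ Ioc (0 : ℝ) 1) =>
    exists_continuousLinearMap_lift hι (T s).toLinearMap.isLinear
      (mul_nonneg hK0 (Real.rpow_nonneg hs.1.le _)) (h s hs)
  exact ⟨S, K, α, hK0, hα.le, hS⟩

theorem CondS3.exists_lift (hS3 : CondS3 ι T B) (hι : Function.Injective ι)
    (hTd : IsImmediatelyDifferentiable T) (hT : IsC0Semigroup T) (hA : IsGenerator T A)
    (hdom : B.domain = A.domain) :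
    ∃ (L : ℝ → V →L[ℂ] V) (K β : ℝ), β < 1 ∧ ∀ s ∈ Ioc (0 : ℝ) 1,
      ‖L s‖ ≤ K * s ^ (-β) ∧ ∀ v, ι (L s v) = val B (T s (ι v)) := by
  obtain ⟨K, β, hK, hβ, h⟩ := hS3
  have hlin : ∀ s ∈ Ioc (0 : ℝ) 1, IsLinearMap ℂ fun v => val B (T s (ι v)) := fun s hs =>
    ((hTd.isLinearMap_val_orbit hT hA hdom hs.1).mk' _ ∘ₗ ι.toLinearMap).isLinear
  have hval : ∀ s ∈ Ioc (0 : ℝ) 1, ∀ v, ∃ y : V, ι y = val B (T s (ι v)) ∧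
      ‖y‖ ≤ K * s ^ (-β) * ‖v‖ := fun s hs v => by
    have hmem : T s (ι v) ∈ B.domain :=
      hdom ▸ LinearPMap.mem_domain_of_mem_graph (hTd.mem_graph hT hA (ι v) hs.1)
    rw [val, dif_pos hmem]
    exact (h s hs v).2 hmem
  choose! L hL using fun (s : ℝ) (hs : s ∈ Ioc (0 : ℝ) 1) =>
    exists_continuousLinearMap_lift hι (hlin s hs)
      (mul_nonneg (zero_le_one.trans hK) (Real.rpow_nonneg hs.1.le _)) (hval s hs)
  exact ⟨L, K, β, hβ.2, hL⟩

theorem CondS3.exists_norm_lift_le (hS3 : CondS3 ι T B) (hι : Function.Injective ι)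
    (hS : ∀ s ∈ Ioc (0 : ℝ) 1, ∀ x, ι (S s x) = T s x) (v : V) :
    ∃ m, ∀ s ∈ Ioc (0 : ℝ) 1, ‖S s (ι v)‖ ≤ m := by
  obtain ⟨K, β, -, -, h⟩ := hS3
  refine ⟨K * ‖v‖, fun s hs => ?_⟩
  obtain ⟨y, hy, hyK⟩ := (h s hs v).1
  rwa [hι ((hS s hs _).trans hy.symm)]

theorem continuousOn_lift_orbit (hι : Function.Injective ι)
    (hTd : IsImmediatelyDifferentiable T) (hT : IsC0Semigroup T)
    (hS : ∀ s ∈ Ioc (0 : ℝ) 1, ∀ x, ι (S s x) = T s x) (x : X) :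
    ContinuousOn (fun s => S s x) (Ioc 0 1) := by
  have hsub : ∀ s ∈ Ioc (0 : ℝ) 1, ∀ a ∈ Ioo 0 s, s - a ∈ Ioc (0 : ℝ) 1 := fun s hs a ha =>
    ⟨sub_pos.2 ha.2, by linarith [hs.2, ha.1]⟩
  refine continuousOn_of_forall_eq_comp_sub (g := fun a t => S a (T t x)) (fun s hs => hs.1)
    hsub (fun a _ => (S a).continuous.comp_continuousOn
      ((hTd.continuousOn_orbit hT x).mono fun t ht => ht.1.le)) fun s hs a ha => hι ?_
  rw [hS s hs, hS a ⟨ha.1, ha.2.le.trans hs.2⟩, ← hT.apply_add ha.1.le (sub_pos.2 ha.2).le,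
    add_sub_cancel]

theorem continuousOn_lift_val_orbit (hι : Function.Injective ι)
    (hTd : IsImmediatelyDifferentiable T) (hT : IsC0Semigroup T)
    (hS : ∀ s ∈ Ioc (0 : ℝ) 1, ∀ x, ι (S s x) = T s x)
    (hL : ∀ s ∈ Ioc (0 : ℝ) 1, ∀ v, ι (L s v) = val B (T s (ι v))) (v : V) :
    ContinuousOn (fun s => L s v) (Ioc 0 1) := by
  have hsub : ∀ s ∈ Ioc (0 : ℝ) 1, ∀ a ∈ Ioo 0 s, s - a ∈ Ioc (0 : ℝ) 1 := fun s hs a ha =>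
    ⟨sub_pos.2 ha.2, by linarith [hs.2, ha.1]⟩
  refine continuousOn_of_forall_eq_comp_sub (g := fun a t => L a (S t (ι v)))
    (fun s hs => hs.1) hsub (fun a _ => (L a).continuous.comp_continuousOn
      (continuousOn_lift_orbit hι hTd hT hS (ι v))) fun s hs a ha => hι ?_
  rw [hL s hs, hL a ⟨ha.1, ha.2.le.trans hs.2⟩, hS _ (hsub s hs a ha),
    ← hT.apply_add ha.1.le (sub_pos.2 ha.2).le, add_sub_cancel]

theorem exists_exp_mul_lt_one_and_integral_rpow_lt_one {K a β q τ : ℝ} (hβ : β < 1) (hq : q < 1)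
    (hτ : 0 < τ) : ∃ t ∈ Ioo 0 τ, Real.exp (a * t) * q < 1 ∧
      ∫ s in (0 : ℝ)..t, Real.exp (a * t) * (K * s ^ (-β)) < 1 := by
  have hβ1 : 0 < 1 - β := sub_pos.2 hβ
  have hcontq : ContinuousAt (fun t : ℝ => Real.exp (a * t) * q) 0 := by fun_prop
  have hcontK : ContinuousAt
      (fun t : ℝ => Real.exp (a * t) * (K * (t ^ (1 - β) / (1 - β)))) 0 := by
    have hrpow : ContinuousAt (fun t : ℝ => t ^ (1 - β)) 0 :=
      Real.continuousAt_rpow_const _ _ (Or.inr hβ1.le)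
    fun_prop
  have hltq : ∀ᶠ t in 𝓝[>] (0 : ℝ), Real.exp (a * t) * q < 1 :=
    (hcontq.eventually_lt_const (by simpa using hq)).filter_mono nhdsWithin_le_nhds
  have hltK : ∀ᶠ t in 𝓝[>] (0 : ℝ), Real.exp (a * t) * (K * (t ^ (1 - β) / (1 - β))) < 1 :=
    (hcontK.eventually_lt_const (by simp [Real.zero_rpow hβ1.ne'])).filter_mono
      nhdsWithin_le_nhds
  obtain ⟨t, ⟨htq, htK⟩, ht⟩ := ((hltq.and hltK).and (Ioo_mem_nhdsGT hτ)).exists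
  refine ⟨t, ht, htq, ?_⟩
  rwa [intervalIntegral.integral_const_mul, intervalIntegral.integral_const_mul,
    integral_rpow (Or.inl (by linarith)), neg_add_eq_sub, Real.zero_rpow hβ1.ne', sub_zero]

theorem eq_of_eq_add_integral_exp_smul {f : ℝ → X → X} {q t : ℝ} (ht : 0 ≤ t)
    (hf : ∀ s ∈ Ioc 0 t, IsLinearMap ℂ (f s))
    (hint : ∀ x, IntervalIntegrable (fun s => f s x) volume 0 t)
    (hq : ∀ x, ∫ s in (0 : ℝ)..t, ‖f s x‖ ≤ q * ‖x‖) (hqt : Real.exp (‖lam‖ * t) * q < 1)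
    {x y g : X} (hx : x = g + ∫ s in (0 : ℝ)..t, Complex.exp (-lam * s) • f s x)
    (hy : y = g + ∫ s in (0 : ℝ)..t, Complex.exp (-lam * s) • f s y) : x = y := by
  have hint' : ∀ x, IntervalIntegrable (fun s : ℝ => Complex.exp (-lam * s) • f s x) volume 0 t :=
    fun x => (hint x).continuousOn_smul (by fun_prop)
  have hsub : x - y = ∫ s in (0 : ℝ)..t, Complex.exp (-lam * s) • f s (x - y) := by
    conv_lhs => rw [hx, hy, add_sub_add_left_eq_sub,
      ← intervalIntegral.integral_sub (hint' x) (hint' y)]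
    refine intervalIntegral.integral_congr_ae (Eventually.of_forall fun s hs => ?_)
    rw [uIoc_of_le ht] at hs
    rw [← smul_sub, (hf s hs).map_sub]
  have hle : ‖x - y‖ ≤ Real.exp (‖lam‖ * t) * q * ‖x - y‖ :=
    calc ‖x - y‖ = ‖∫ s in (0 : ℝ)..t, Complex.exp (-lam * s) • f s (x - y)‖ := by rw [← hsub]
      _ ≤ ∫ s in (0 : ℝ)..t, Real.exp (‖lam‖ * t) * ‖f s (x - y)‖ := by
        refine intervalIntegral.norm_integral_le_of_norm_le ht
          (Eventually.of_forall fun s hs => ?_) ((hint _).norm.const_mul _)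
        rw [norm_smul]
        gcongr
        exact norm_exp_neg_mul_le lam hs.1.le hs.2
      _ ≤ Real.exp (‖lam‖ * t) * (q * ‖x - y‖) := by
        rw [intervalIntegral.integral_const_mul]
        gcongr
        exact hq _
      _ = Real.exp (‖lam‖ * t) * q * ‖x - y‖ := (mul_assoc _ _ _).symm
  refine sub_eq_zero.1 (norm_le_zero_iff.1 ?_)
  nlinarith [norm_nonneg (x - y)]

theorem exists_eq_add_integral_exp_smul [CompleteSpace V] {k : ℝ → ℝ} {t : ℝ} (ht : 0 ≤ t)
    (hcont : ∀ v, ContinuousOn (fun s => L s v) (Ioc 0 t)) (hL : ∀ s ∈ Ioc 0 t, ‖L s‖ ≤ k s)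
    (hk : IntervalIntegrable k volume 0 t)
    (hk1 : ∫ s in (0 : ℝ)..t, Real.exp (‖lam‖ * t) * k s < 1) (g : V) :
    ∃ v, IntervalIntegrable (fun s : ℝ => Complex.exp (-lam * s) • L s v) volume 0 t ∧
      v = g + ∫ s in (0 : ℝ)..t, Complex.exp (-lam * s) • L s v := by
  refine exists_eq_add_integral_apply (L := fun s => Complex.exp (-lam * s) • L s) ht
    (fun v => (ContinuousOn.fun_smul (by fun_prop) (hcont v)).aestronglyMeasurable
      measurableSet_Ioc) (fun s hs => ?_) (hk.const_mul _) hk1 g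
  rw [norm_smul]
  gcongr
  · exact norm_exp_neg_mul_le lam hs.1.le hs.2
  · exact hL s hs

/-- The source `w = B u` of the eigenvalue equation `(lam - A) u = w` solves a Volterra equation
in `X`; the solution of the same equation in `V` is mapped to `w` because solutions in `X` are
unique. -/
theorem source_mem_range [CompleteSpace X] [CompleteSpace V] (hι : Function.Injective ι)
    (hTd : IsImmediatelyDifferentiable T) (hT : IsC0Semigroup T) (hA : IsGenerator T A)
    (hdom : B.domain = A.domain) (hB : FactorsThrough A B z₀ C) (hS2 : CondS2 T A B)
    (hS3 : CondS3 ι T B) (hS : ∀ s ∈ Ioc (0 : ℝ) 1, ∀ x, ι (S s x) = T s x)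
    (hu : (u, lam • u - w) ∈ A.graph) (hw : (u, w) ∈ B.graph) : w ∈ range ι := by
  obtain ⟨q, hq, t₀, ht₀, hM⟩ := hS2.exists_integral_norm_val_orbit_le hB hTd hT hA
  obtain ⟨L, K, β, hβ, hL⟩ := hS3.exists_lift hι hTd hT hA hdom
  obtain ⟨t, ht, hqt, hKt⟩ := exists_exp_mul_lt_one_and_integral_rpow_lt_one (K := K) (a := ‖lam‖)
    hβ hq.2 (lt_min one_pos ht₀)
  have ht0 : 0 < t := ht.1
  have htt₀ : t ≤ t₀ := ht.2.le.trans (min_le_right _ _)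
  have hmem : Ioc 0 t ⊆ Ioc 0 1 := Ioc_subset_Ioc_right (ht.2.le.trans (min_le_left _ _))
  have hhalf : t / 2 ∈ Ioc (0 : ℝ) 1 := hmem ⟨by linarith, by linarith⟩
  have hint : ∀ x, IntervalIntegrable (fun s => val B (T s x)) volume 0 t := fun x =>
    (hM x).1.mono_set (uIcc_subset_uIcc_left (by rw [uIcc_of_le ht₀.le]; exact ⟨ht0.le, htt₀⟩))
  have hMt : ∀ x, ∫ s in (0 : ℝ)..t, ‖val B (T s x)‖ ≤ q * ‖x‖ := fun x =>
    (intervalIntegral.integral_mono_interval le_rfl ht0.le htt₀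
      (Eventually.of_forall fun _ => norm_nonneg _) (hM x).1.norm).trans (hM x).2
  obtain ⟨v, hv_int, hv⟩ := exists_eq_add_integral_exp_smul ht0.le
    (fun v => (continuousOn_lift_val_orbit hι hTd hT hS (fun s hs => (hL s hs).2) v).mono hmem)
    (fun s hs => (hL s (hmem hs)).1)
    ((intervalIntegral.intervalIntegrable_rpow' (by linarith)).const_mul K) hKt
    (Complex.exp (-lam * t) • L (t / 2) (S (t / 2) u))
  have hιv : ι v = Complex.exp (-lam * t) • val B (T t u) +
      ∫ s in (0 : ℝ)..t, Complex.exp (-lam * s) • val B (T s (ι v)) := by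
    conv_lhs => rw [hv, map_add, map_smul, (hL _ hhalf).2, hS _ hhalf,
      ← hT.apply_add hhalf.1.le hhalf.1.le, add_halves, ← ι.intervalIntegral_comp_comm hv_int]
    congr 1
    refine intervalIntegral.integral_congr_ae (Eventually.of_forall fun s hs => ?_)
    rw [uIoc_of_le ht0.le] at hs
    rw [map_smul, (hL s (hmem hs)).2]
  exact ⟨v, eq_of_eq_add_integral_exp_smul ht0.le
    (fun s hs => hTd.isLinearMap_val_orbit hT hA hdom hs.1) hint hMt hqt hιv
    (source_eq_add_integral_val_orbit hTd hT hA hB hu hw ht0.le (hint w))⟩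

/-- The solution `u` of `(lam - A) u = w` as an element of `V`, by the variation of constants
formula on `[0, 1]`. `S s` stands for `T s` regarded as an operator from `X` to `V`. -/
noncomputable def smoothVector (S : ℝ → X →L[ℂ] V) (lam : ℂ) (u w : X) : V :=
  Complex.exp (-lam) • S 1 u + ∫ s in (0 : ℝ)..1, Complex.exp (-lam * s) • S s w

theorem map_smoothVector [CompleteSpace X] [CompleteSpace V] (hι : Function.Injective ι)
    (hTd : IsImmediatelyDifferentiable T) (hT : IsC0Semigroup T) (hA : IsGenerator T A)
    (hS : ∀ s ∈ Ioc (0 : ℝ) 1, ∀ x, ι (S s x) = T s x) (hu : (u, lam • u - w) ∈ A.graph)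
    (hw : ∃ m, ∀ s ∈ Ioc (0 : ℝ) 1, ‖S s w‖ ≤ m) : ι (smoothVector S lam u w) = u := by
  obtain ⟨m, hm⟩ := hw
  have hint : IntervalIntegrable (fun s => S s w) volume 0 1 := by
    refine (intervalIntegrable_const (c := m)).mono_fun' ?_ ?_ <;> rw [uIoc_of_le zero_le_one]
    · exact (continuousOn_lift_orbit hι hTd hT hS w).aestronglyMeasurable measurableSet_Ioc
    · exact (ae_restrict_iff' measurableSet_Ioc).2 (Eventually.of_forall hm)
  have hint_exp : IntervalIntegrable (fun s : ℝ => Complex.exp (-lam * s) • S s w) volume 0 1 :=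
    hint.continuousOn_smul (by fun_prop)
  rw [smoothVector, map_add, map_smul, hS 1 ⟨one_pos, le_rfl⟩,
    ← ι.intervalIntegral_comp_comm hint_exp]
  conv_rhs => rw [eigenvector_eq_add_integral_orbit hTd hT hA hu zero_le_one]
  rw [Complex.ofReal_one, mul_one]
  congr 1
  refine intervalIntegral.integral_congr_ae (Eventually.of_forall fun s hs => ?_)
  rw [uIoc_of_le zero_le_one] at hs
  rw [map_smul, hS s hs]

theorem differentiableOn_smoothVector [CompleteSpace V] (hι : Function.Injective ι)
    (hTd : IsImmediatelyDifferentiable T) (hT : IsC0Semigroup T) {K α : ℝ} (hK : 0 ≤ K)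
    (hα : 0 ≤ α) (hS : ∀ s ∈ Ioc (0 : ℝ) 1, ‖S s‖ ≤ K * s ^ (-α) ∧ ∀ x, ι (S s x) = T s x)
    {U : Set ℂ} (hU : IsOpen U) {lam : ℂ → ℂ} {u w : ℂ → X} (hlam : DifferentiableOn ℂ lam U)
    (hu : DifferentiableOn ℂ u U) (hw : DifferentiableOn ℂ w U)
    (hbdd : ∀ κ ∈ U, ∃ m, ∀ s ∈ Ioc (0 : ℝ) 1, ‖S s (w κ)‖ ≤ m) :
    DifferentiableOn ℂ (fun κ => smoothVector S (lam κ) (u κ) (w κ)) U := by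
  have hexp : ∀ κ, ∀ s ∈ Ioc (0 : ℝ) 1, ‖Complex.exp (-lam κ * s)‖ ≤ Real.exp ‖lam κ‖ :=
    fun κ s hs => by simpa using norm_exp_neg_mul_le (lam κ) hs.1.le hs.2
  refine (hlam.neg.cexp.smul ((S 1).differentiable.comp_differentiableOn hu)).add
    (differentiableOn_integral_of_pointwise_bounded hα (fun κ _ => ?_) (fun s _ => ?_)
      (fun c hc => ?_) fun κ hκ => ?_)
  · exact (ContinuousOn.fun_smul (by fun_prop) (continuousOn_lift_orbit hι hTd hT
      (fun s hs => (hS s hs).2) _)).aestronglyMeasurable measurableSet_Ioc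
  · exact (hlam.neg.mul_const _).cexp.smul ((S s).differentiable.comp_differentiableOn hw)
  · refine ⟨Real.exp (‖lam c‖ + 1) * (K * (‖w c‖ + 1)), ?_⟩
    have hlam_lt := (hlam.continuousOn.continuousAt (hU.mem_nhds hc)).norm.eventually_lt_const
      (lt_add_one ‖lam c‖)
    have hw_lt := (hw.continuousOn.continuousAt (hU.mem_nhds hc)).norm.eventually_lt_const
      (lt_add_one ‖w c‖)
    filter_upwards [hU.mem_nhds hc, hlam_lt, hw_lt] with z hz hlam_z hw_z
    refine ⟨hz, fun s hs => ?_⟩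
    have : 0 ≤ K * s ^ (-α) := mul_nonneg hK (Real.rpow_nonneg hs.1.le _)
    calc ‖Complex.exp (-lam z * s) • S s (w z)‖
        ≤ Real.exp (‖lam c‖ + 1) * (K * s ^ (-α) * (‖w c‖ + 1)) := by
          rw [norm_smul]
          gcongr
          · exact (hexp z s hs).trans (Real.exp_le_exp.2 hlam_z.le)
          · exact (S s).le_of_opNorm_le_of_le (hS s hs).1 hw_z.le
      _ = Real.exp (‖lam c‖ + 1) * (K * (‖w c‖ + 1)) * s ^ (-α) := by ring
  · obtain ⟨m, hm⟩ := hbdd κ hκ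
    refine ⟨Real.exp ‖lam κ‖ * m, fun s hs => ?_⟩
    rw [norm_smul]
    gcongr
    exacts [hexp κ s hs, hm s hs]

theorem exists_differentiableOn_lift_eigenvector [CompleteSpace X] [CompleteSpace V]
    (hι : Function.Injective ι) (hTd : IsImmediatelyDifferentiable T) (hT : IsC0Semigroup T)
    (hA : IsGenerator T A) (hR : IsResolventAt A z₀ R) (hS1 : CondS1 ι T) {B : ℂ → X →ₗ.[ℂ] X}
    {U : Set ℂ} (hU : IsOpen U) (hB : ∀ κ ∈ U, IsBoundedOnDomain A (B κ))
    (hS2 : ∀ κ ∈ U, CondS2 T A (B κ)) (hS3 : ∀ κ ∈ U, CondS3 ι T (B κ))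
    {lam : ℂ → ℂ} {u w : ℂ → X} (hlam : DifferentiableOn ℂ lam U) (hu : DifferentiableOn ℂ u U)
    (hw : DifferentiableOn ℂ w U) (hAu : ∀ κ ∈ U, (u κ, lam κ • u κ - w κ) ∈ A.graph)
    (hBu : ∀ κ ∈ U, (u κ, w κ) ∈ (B κ).graph) :
    ∃ v : ℂ → V, DifferentiableOn ℂ v U ∧ ∀ κ ∈ U, ι (v κ) = u κ := by
  obtain ⟨S, K, α, hK, hα, hS⟩ := hS1.exists_lift hι
  have hS_eq : ∀ s ∈ Ioc (0 : ℝ) 1, ∀ x, ι (S s x) = T s x := fun s hs => (hS s hs).2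
  have hbdd : ∀ κ ∈ U, ∃ m, ∀ s ∈ Ioc (0 : ℝ) 1, ‖S s (w κ)‖ ≤ m := fun κ hκ => by
    obtain ⟨C, hC⟩ := (hB κ hκ).exists_factorsThrough hR
    obtain ⟨v, hv⟩ := source_mem_range hι hTd hT hA (hB κ hκ).1 hC (hS2 κ hκ) (hS3 κ hκ) hS_eq
      (hAu κ hκ) (hBu κ hκ)
    exact hv ▸ (hS3 κ hκ).exists_norm_lift_le hι hS_eq v
  exact ⟨fun κ => smoothVector S (lam κ) (u κ) (w κ),
    differentiableOn_smoothVector hι hTd hT hK hα hS hU hlam hu hw hbdd,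
    fun κ hκ => map_smoothVector hι hTd hT hA hS_eq (hAu κ hκ) (hbdd κ hκ)⟩

end Embedded

/-! ### Holomorphic families -/

section Families

variable {X : Type*} [NormedAddCommGroup X] [NormedSpace ℂ X] {A : X →ₗ.[ℂ] X} {z₀ : ℂ}
  {R : X →L[ℂ] X}

protected theorem IsBoundedOnDomain.addBounded {B : X →ₗ.[ℂ] X} (hB : IsBoundedOnDomain A B)
    (L : X →L[ℂ] X) : IsBoundedOnDomain (addBounded A L) B := by
  obtain ⟨hdom, M, hM⟩ := hB
  refine ⟨hdom, |M| * (1 + ‖L‖), fun x hA hB => ?_⟩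
  have hAx : ‖A ⟨x, hA⟩‖ ≤ ‖L‖ * ‖x‖ + ‖addBounded A L ⟨x, hA⟩‖ := by
    calc ‖A ⟨x, hA⟩‖ = ‖(L x + A ⟨x, hA⟩) - L x‖ := by rw [add_sub_cancel_left]
      _ ≤ ‖L x + A ⟨x, hA⟩‖ + ‖L x‖ := norm_sub_le _ _
      _ ≤ _ := by rw [add_comm]; gcongr; exacts [L.le_opNorm x, le_rfl]
  calc ‖B ⟨x, hB⟩‖ ≤ M * (‖x‖ + ‖A ⟨x, hA⟩‖) := hM x hA hB
    _ ≤ |M| * (‖x‖ + (‖L‖ * ‖x‖ + ‖addBounded A L ⟨x, hA⟩‖)) := by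
        gcongr
        exact le_abs_self M
    _ ≤ _ := by
        rw [mul_assoc]
        gcongr
        nlinarith [mul_nonneg (norm_nonneg L)
          (norm_nonneg (addBounded A L ⟨x, hA⟩))]

theorem exists_differentiableOn_factorsThrough [CompleteSpace X] {L : X →L[ℂ] X}
    (hR : IsResolventAt (addBounded A L) z₀ R) {B : ℂ → X →ₗ.[ℂ] X} {U : Set ℂ} (hU : IsOpen U)
    (hB : ∀ κ ∈ U, IsBoundedOnDomain A (B κ))
    (hol : ∀ x ∈ A.domain, DifferentiableOn ℂ (fun κ => val (A + B κ) x) U) :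
    ∃ C : ℂ → X →L[ℂ] X, DifferentiableOn ℂ C U ∧
      ∀ κ ∈ U, FactorsThrough (addBounded A L) (B κ) z₀ (C κ) := by
  choose! C hC using fun κ hκ => ((hB κ hκ).addBounded L).exists_factorsThrough hR
  refine ⟨C, differentiableOn_of_forall_apply hU fun y => ?_, hC⟩
  have hRA := mem_graph_addBounded.1 (hR.apply_mem_graph y)
  refine ((hol (R y) (mk_mem_graph_iff.1 hRA).1).sub_const (z₀ • R y - y - L (R y))).congr
    fun κ hκ => ?_
  have hRB : (R y, C κ y) ∈ (B κ).graph := by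
    simpa only [sub_sub_cancel] using hC κ hκ _ _ (hR.apply_mem_graph y)
  rw [val_eq_of_mem_graph (mem_graph_add hRA hRB), add_sub_cancel_left]

theorem FactorsThrough.eq_zero {B : X →ₗ.[ℂ] X} {C : X →L[ℂ] X} (hC : FactorsThrough A B z₀ C)
    (hR : IsResolventAt A z₀ R) (hB : ∀ x : B.domain, B x = 0) : C = 0 := by
  ext y
  have hRB := hC _ _ (hR.apply_mem_graph y)
  rw [sub_sub_cancel] at hRB
  obtain ⟨hx, hCy⟩ := mk_mem_graph_iff.1 hRB
  rw [← hCy, hB, zero_apply]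

theorem exists_differentiableOn_isSimpleEigendata [CompleteSpace X] {B : ℂ → X →ₗ.[ℂ] X}
    {lam₀ : ℂ} {r ρ : ℝ} (hpole : IsResolventPole A lam₀) (hsimple : IsAlgSimple A lam₀)
    (hr : 0 < r) (hiso : closedBall lam₀ r ∩ spec A = {lam₀}) (hρ : 0 < ρ)
    (hB : ∀ κ ∈ ball (0 : ℂ) ρ, IsBoundedOnDomain A (B κ)) (hB0 : ∀ x : (B 0).domain, B 0 x = 0)
    (hol : ∀ x ∈ A.domain, DifferentiableOn ℂ (fun κ => val (A + B κ) x) (ball 0 ρ)) :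
    ∃ δ, 0 < δ ∧ δ ≤ ρ ∧ ∃ (lam : ℂ → ℂ) (u w : ℂ → X) (ψ : ℂ → X →L[ℂ] ℂ),
      DifferentiableOn ℂ lam (ball 0 δ) ∧ DifferentiableOn ℂ u (ball 0 δ) ∧
      DifferentiableOn ℂ w (ball 0 δ) ∧ DifferentiableOn ℂ ψ (ball 0 δ) ∧
      ∀ κ ∈ ball 0 δ, IsSimpleEigendata A (B κ) lam₀ r (lam κ) (u κ) (w κ) (ψ κ) := by
  obtain ⟨e, φ, hD⟩ := exists_isDeflation hpole hsimple hr hiso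
  obtain ⟨R, hR⟩ := hD.subset_resolventSet (mem_closedBall_self hr.le)
  obtain ⟨C, hC, hCB⟩ := exists_differentiableOn_factorsThrough hR isOpen_ball hB hol
  have h0 : (0 : ℂ) ∈ ball 0 ρ := mem_ball_self hρ
  have hC0 : Tendsto C (𝓝 0) (𝓝 0) := by
    simpa only [(hCB 0 h0).eq_zero hR hB0] using
      ((hC 0 h0).differentiableAt (isOpen_ball.mem_nhds h0)).continuousAt.tendsto
  obtain ⟨Λ, u, w, ψ, hev⟩ := hD.exists_isSimpleEigendata hr
  obtain ⟨δ', hδ', hball⟩ := Metric.eventually_nhds_iff_ball.1 (hC0.eventually hev)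
  have hball_ρ : ball (0 : ℂ) (min δ' ρ) ⊆ ball 0 ρ := ball_subset_ball (min_le_right _ _)
  replace hball := fun κ (hκ : κ ∈ ball (0 : ℂ) (min δ' ρ)) =>
    hball κ (ball_subset_ball (min_le_left _ _) hκ)
  have hCδ := hC.mono hball_ρ
  exact ⟨min δ' ρ, lt_min hδ' hρ, min_le_right _ _, Λ ∘ C, u ∘ C, w ∘ C, ψ ∘ C,
    fun κ hκ => (hball κ hκ).1.comp_differentiableWithinAt κ (hCδ κ hκ),
    fun κ hκ => (hball κ hκ).2.1.comp_differentiableWithinAt κ (hCδ κ hκ),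
    fun κ hκ => (hball κ hκ).2.2.1.comp_differentiableWithinAt κ (hCδ κ hκ),
    fun κ hκ => (hball κ hκ).2.2.2.1.comp_differentiableWithinAt κ (hCδ κ hκ),
    fun κ hκ => (hball κ hκ).2.2.2.2 (B κ) (hCB κ (hball_ρ hκ))⟩

theorem differentiableOn_smulRight {E F : Type*} [NormedAddCommGroup E] [NormedSpace ℂ E]
    [NormedAddCommGroup F] [NormedSpace ℂ F] {ψ : ℂ → E →L[ℂ] ℂ} {v : ℂ → F} {U : Set ℂ}
    (hψ : DifferentiableOn ℂ ψ U) (hv : DifferentiableOn ℂ v U) :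
    DifferentiableOn ℂ (fun κ => (ψ κ).smulRight (v κ)) U :=
  (isBoundedBilinearMap_smulRight (𝕜 := ℂ) (E := E) (F := F)).differentiable.comp_differentiableOn
    (hψ.prodMk hv)

end Families

end AnalyticPerturbation

open AnalyticPerturbation in
theorem mainTheorem3_general
    {X V : Type*} [NormedAddCommGroup X] [NormedSpace ℂ X] [CompleteSpace X]
    [NormedAddCommGroup V] [NormedSpace ℂ V] [CompleteSpace V]
    (ι : V →L[ℂ] X) (hι : Function.Injective ι)
    (T : ℝ → X →L[ℂ] X) (hT : IsC0Semigroup T) (hTd : IsImmediatelyDifferentiable T)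
    (A : X →ₗ.[ℂ] X) (hA : IsGenerator T A)
    (B : ℂ → X →ₗ.[ℂ] X)
    (hB : ∀ κ ∈ ball (0 : ℂ) 1, IsBoundedOnDomain A (B κ))
    (hB0 : ∀ x : (B 0).domain, B 0 x = 0)
    (hS1 : CondS1 ι T)
    (hS2 : ∀ κ ∈ ball (0 : ℂ) 1, CondS2 T A (B κ))
    (hS3 : ∀ κ ∈ ball (0 : ℂ) 1, CondS3 ι T (B κ))
    (hol : ∀ x ∈ A.domain, DifferentiableOn ℂ (fun κ => val (A + B κ) x) (ball 0 1))
    (lam₀ : ℂ) (hpole : IsResolventPole A lam₀) (hsimple : IsAlgSimple A lam₀)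
    (r : ℝ) (hr : 0 < r) (hiso : closedBall lam₀ r ∩ spec A = {lam₀}) :
    ∃ δ : ℝ, 0 < δ ∧ δ ≤ 1 ∧
      ∃ (lam : ℂ → ℂ) (P : ℂ → X →L[ℂ] X) (PV : ℂ → V →L[ℂ] V),
        (∀ κ ∈ ball (0 : ℂ) δ,
          spec (A + B κ) ∩ ball lam₀ r = {lam κ} ∧
          IsResolventPole (A + B κ) (lam κ) ∧
          IsAlgSimple (A + B κ) (lam κ) ∧
          IsSpectralProjection (A + B κ) (lam κ) (P κ) ∧
          range (P κ) ⊆ range ι ∧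
          ∀ v : V, ι (PV κ v) = P κ (ι v)) ∧
        AnalyticOnNhd ℂ lam (ball 0 δ) ∧
        AnalyticOnNhd ℂ P (ball 0 δ) ∧
        AnalyticOnNhd ℂ PV (ball 0 δ) := by
  obtain ⟨δ, hδ, hδ1, lam, u, w, ψ, hlam, hu, hw, hψ, hdata⟩ :=
    exists_differentiableOn_isSimpleEigendata hpole hsimple hr hiso one_pos hB hB0 hol
  have hsub : ball (0 : ℂ) δ ⊆ ball 0 1 := ball_subset_ball hδ1
  obtain ⟨z, R, hR⟩ := hpole.2.1.exists
  obtain ⟨v, hv, hvu⟩ := exists_differentiableOn_lift_eigenvector hι hTd hT hA hR hS1 isOpen_ball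
    (fun κ hκ => hB κ (hsub hκ)) (fun κ hκ => hS2 κ (hsub hκ)) (fun κ hκ => hS3 κ (hsub hκ))
    hlam hu hw (fun κ hκ => (hdata κ hκ).mem_graph)
    (fun κ hκ => (hdata κ hκ).mem_graph_perturbation)
  have hψι : DifferentiableOn ℂ (fun κ => (ψ κ).comp ι) (ball 0 δ) :=
    hψ.clm_comp (differentiableOn_const ι)
  refine ⟨δ, hδ, hδ1, lam, fun κ => (ψ κ).smulRight (u κ),
    fun κ => ((ψ κ).comp ι).smulRight (v κ), fun κ hκ => ?_,
    hlam.analyticOnNhd isOpen_ball, (differentiableOn_smulRight hψ hu).analyticOnNhd isOpen_ball,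
    (differentiableOn_smulRight hψι hv).analyticOnNhd isOpen_ball⟩
  obtain ⟨hspec, hpole_κ, hsimple_κ, hproj, -, -⟩ := hdata κ hκ
  refine ⟨hspec, hpole_κ, hsimple_κ, hproj, ?_, fun x => by simp [hvu κ hκ]⟩
  rintro _ ⟨x, rfl⟩
  exact ⟨ψ κ x • v κ, by rw [map_smul, hvu κ hκ]; rfl⟩

open AnalyticPerturbation in
theorem mainTheorem3
    {X V : Type*} [NormedAddCommGroup X] [NormedSpace ℂ X] [CompleteSpace X]
    [NormedAddCommGroup V] [NormedSpace ℂ V] [CompleteSpace V]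
    -- the continuous embedding of `V` into `X`, with (B1) or (B2)
    (ι : V →L[ℂ] X) (hι : Function.Injective ι)
    (hV : TopologicalSpace.SeparableSpace V ∨ IsClosed (ι '' closedBall (0 : V) 1))
    -- the immediately differentiable semigroup and its generator
    (T : ℝ → X →L[ℂ] X) (hT : IsC0Semigroup T) (hTd : IsImmediatelyDifferentiable T)
    (A : X →ₗ.[ℂ] X) (hA : IsGenerator T A)
    -- the perturbations; (S1) does not involve `κ`, the constants in (S2), (S3) may depend on `κ`
    (B : ℂ → X →ₗ.[ℂ] X)
    (hB : ∀ κ ∈ ball (0 : ℂ) 1, IsBoundedOnDomain A (B κ))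
    (hB0 : ∀ x : (B 0).domain, B 0 x = 0)
    (hS1 : CondS1 ι T)
    (hS2 : ∀ κ ∈ ball (0 : ℂ) 1, CondS2 T A (B κ))
    (hS3 : ∀ κ ∈ ball (0 : ℂ) 1, CondS3 ι T (B κ))
    (hol : ∀ x ∈ A.domain, DifferentiableOn ℂ (fun κ => val (A + B κ) x) (ball 0 1))
    -- the unperturbed eigenvalue
    (lam₀ : ℂ) (hpole : IsResolventPole A lam₀) (hsimple : IsAlgSimple A lam₀)
    (r : ℝ) (hr : 0 < r) (hiso : closedBall lam₀ r ∩ spec A = {lam₀})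
    (hβ : Tendsto (fun κ => relSup A (B κ) lam₀ r) (𝓝[≠] 0) (𝓝 0)) :
    ∃ δ : ℝ, 0 < δ ∧ δ ≤ 1 ∧
      ∃ (lam : ℂ → ℂ) (P : ℂ → X →L[ℂ] X) (PV : ℂ → V →L[ℂ] V),
        (∀ κ ∈ ball (0 : ℂ) δ,
          spec (A + B κ) ∩ ball lam₀ r = {lam κ} ∧
          IsResolventPole (A + B κ) (lam κ) ∧
          IsAlgSimple (A + B κ) (lam κ) ∧
          IsSpectralProjection (A + B κ) (lam κ) (P κ) ∧
          range (P κ) ⊆ range ι ∧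
          -- `PV κ` is `P κ` as an operator on `V`
          ∀ v : V, ι (PV κ v) = P κ (ι v)) ∧
        AnalyticOnNhd ℂ lam (ball 0 δ) ∧
        AnalyticOnNhd ℂ P (ball 0 δ) ∧
        AnalyticOnNhd ℂ PV (ball 0 δ) :=
  mainTheorem3_general ι hι T hT hTd A hA B hB hB0 hS1 hS2 hS3 hol lam₀ hpole hsimple r hr hiso
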